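/- **Setting.** Fix $K\in\mathbb N$ and an integer $M\ge 16$. All limits are along a sequence of panels indexed by $n$, with cross-sectional dimension $N=N_n\ge1$ and time dimension $T=T_n\ge 1$ (the index $n$ is suppressed; all objects may depend on $n$, all constants $C,c_1,\dots,c_5,\psi,a,\eta$ do not). The model is $y_{i,t}=x_{i,t}'\beta_i+\varepsilon_{i,t}$, $1\le i\le N$, $1\le t\le T$, with random $K$-dimensional regressors $x_{i,t}$, fixed slopes $\beta_i\in\mathbb R^K$, and real errors $\varepsilon_{i,t}$. Write $X_i=(x_{i,1},\dots,x_{i,T})'$, $y_i=(y_{i,1},\dots,y_{i,T})'$, $\varepsilon_i=(\varepsilon_{i,1},\dots,\varepsilon_{i,T})'$, $\mathbf X=(X_1,\dots,X_N)$, $\hat\beta_i=[X_i'X_i]^{-1}X_i'y_i$; $\|\cdot\|_2$ is the Euclidean/Frobenius norm. For positive $a_n$ and random variables $Z_n$, $$Z_n=\mathcal O_P^{|\mathbf X}(a_n)\iff\forall\delta>0:\ \lim_{C\to\infty}\limsup_n\mathbb P\big(\mathbb P(|Z_n|/a_n>C\mid\mathbf X)>\delta\big)=0,$$ $$Z_n=o_P^{|\mathbf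 X}(a_n)\iff\forall C,\delta>0:\ \lim_n\mathbb P\big(\mathbb P(|Z_n|/a_n>C\mid\mathbf X)>\delta\big)=0.$$ The mixing coefficient $\alpha(r)$ is the supremum of $|\mathbb P(A\cap B)-\mathbb P(A)\mathbb P(B)|$ over $A\in\sigma(\varepsilon_z:z\in\mathcal I)$, $B\in\sigma(\varepsilon_z:z\in\mathcal J)$ and index sets $\mathcal I,\mathcal J\subset\{1,\dots,N\}\times\{1,\dots,T\}$ at distance at least $r$ in the maximum norm. **Assumptions.** 1. (i) $\max_{i,t}\mathbb E|\varepsilon_{i,t}|^M\le C$ and $\max_{i,t}\mathbb E\|x_{i,t}\|_2^M\le C$. (ii) The errors are centered and $(\varepsilon_1',\dots,\varepsilon_N')'$ has covariance matrix $\Sigma_N\otimes\Sigma_T$, where $\Sigma_N$ is an $N\times N$ covariance matrix and $\Sigma_T$ is the $T\times T$ covariance matrix of a stationary process. (iii) $(\varepsilon_{i,t})_{i\le N,t\le T}$ and $\mathbf X$ are independent. (iv) $x_{i,T+1}\in\mathbb R^K$ are non-random, and $(\varepsilon_{i,T+1})_{i\le N}$ is independent of $((\varepsilon_{i,t})_{i\le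 N,t\le T},\mathbf X)$, centered, with covariance matrix $(\Sigma_T)_{1,1}\Sigma_N$. 2. (i) There are positive definite $Q_i$ with $\max_i\|X_i'X_i/T-Q_i\|_2\to0$ in probability, $0<c_1\le\min_i\lambda_{\min}(Q_i)$ and $\max_i\|Q_i\|_2\le c_2$. (ii) $\max_i\|x_{i,T+1}\|_2\le c_3$. (iii) For some $\psi>1$, $\alpha(r)\le\psi^{-r}$ for all sufficiently large $r$ (uniformly in $n$). 3. (i) $\max_i\|\beta_i\|_2\le c_4$. (ii) $\max_{i,j}\|\beta_i-\beta_j\|_2\le c_5/\sqrt T$. (iii) $N/T^\eta\to0$ for some $\eta\in(0,2)$. **Estimator.** For a bandwidth $b=b_n>0$ put $$E_1=\mathrm{Tr}\Big[\Sigma_T\sum_{i=1}^N\tfrac1N(\Sigma_N)_{i,i}X_i[X_i'X_i]^{-1}x_{i,T+1}x_{i,T+1}'[X_i'X_i]^{-1}X_i'\Big],$$ $$\hat\xi_i(h)=\frac1{T-h-K}\sum_{t=1}^{T-h}(y_i-X_i\hat\beta_i)_t(y_i-X_i\hat\beta_i)_{t+h},\qquad \hat\Sigma^{(i,i)}(b)=\big(\hat\xi_i(|s-t|)\,\mathbb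 I\{|s-t|<b\}\big)_{1\le s,t\le T},$$ $$\hat E_1=\frac1N\sum_{i=1}^N\mathrm{Tr}\Big[\hat\Sigma^{(i,i)}(b)X_i[X_i'X_i]^{-1}x_{i,T+1}x_{i,T+1}'[X_i'X_i]^{-1}X_i'\Big].$$ **Lemma (exponential mixing).** Suppose that Assumptions 1, 2 and 3 hold. If $\log T/b\to0$ and $b/T\to0$, then $$|\hat E_1-E_1|=\mathcal O_P^{|\mathbf X}\Big(\frac b{T^2}+\frac{b^{7/4}}{\sqrt N\,T^{3/2}}\Big).$$ If $b=T^\rho$ with $0<\rho<\min(1-\frac\eta2,\frac27)$, then the rate in brackets is $o(1/(\sqrt N T))$, and $|\hat E_1-E_1|=o_P^{|\mathbf X}(1/(\sqrt NT))$. **Lemma (polynomial mixing).** Suppose that Assumptions 1, 2(i)-(ii) and 3(ii) hold, that $\alpha(r)\le Cr^{-a}$ for all $r\ge1$, with $a>\frac{24(M+2)}{M-3}$, and that $N/T^\eta\to0$ with $0<\eta\le2-\frac{2M}{a(M-2)+M}$. If $b\ge1$ and $b/T\to0$, then $$|\hat E_1-E_1|=\mathcal O_P^{|\mathbf X}\Big(\frac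 b{T^2}+\frac{b^{-a(1-2/M)+1}}{T}+\frac{b^{7/4}}{\sqrt N\,T^{3/2}}\Big).$$ If $b=T^\rho$ with $\frac{\eta}{a(1-2/M)+1}<\rho<\min(1-\frac\eta2,\frac27)$, then the rate in brackets is $o(1/(\sqrt N T))$, and $|\hat E_1-E_1|=o_P^{|\mathbf X}(1/(\sqrt NT))$. -/

import Mathlib

open MeasureTheory ProbabilityTheory Filter Topology
open scoped Kronecker

noncomputable section

/-! ### Norms -/

section Norms
attribute [local instance] Matrix.frobeniusNormedAddCommGroup

/-- The Frobenius norm of a real matrix. -/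
def frobNorm {m n : ℕ} (A : Matrix (Fin m) (Fin n) ℝ) : ℝ := ‖A‖

end Norms

/-- The Euclidean norm of a real vector. -/
def euclNorm {m : ℕ} (v : Fin m → ℝ) : ℝ := ‖(WithLp.toLp 2 v : EuclideanSpace ℝ (Fin m))‖

/-! ### Conditional Landau symbols -/

/-- `Z n = O_P^{| Y n} (a n)`:  for every `δ > 0`,
`lim_{C → ∞} limsup_n P (P (|Z n| / a n > C | Y n) > δ) = 0`. -/
def IsCondBigOP {Ω : Type*} [MeasurableSpace Ω] (P : Measure Ω) {E : ℕ → Type*}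
    [∀ n, MeasurableSpace (E n)] (Y : ∀ n, Ω → E n) (Z : ℕ → Ω → ℝ) (a : ℕ → ℝ) : Prop :=
  ∀ δ : ℝ, 0 < δ →
    Tendsto
      (fun C : ℝ => limsup (fun n : ℕ =>
        P {ω | δ < (P⟦{ω' | C < |Z n ω'| / a n} | MeasurableSpace.comap (Y n) inferInstance⟧) ω})
        atTop)
      atTop (𝓝 0)

/-- `Z n = o_P^{| Y n} (a n)`:  for all `C, δ > 0`,
`lim_n P (P (|Z n| / a n > C | Y n) > δ) = 0`. -/
def IsCondLittleOP {Ω : Type*} [MeasurableSpace Ω] (P : Measure Ω) {E : ℕ → Type*}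
    [∀ n, MeasurableSpace (E n)] (Y : ∀ n, Ω → E n) (Z : ℕ → Ω → ℝ) (a : ℕ → ℝ) : Prop :=
  ∀ C δ : ℝ, 0 < C → 0 < δ →
    Tendsto
      (fun n : ℕ =>
        P {ω | δ < (P⟦{ω' | C < |Z n ω'| / a n} | MeasurableSpace.comap (Y n) inferInstance⟧) ω})
      atTop (𝓝 0)

/-! ### Strong mixing coefficients of a finite panel -/

/-- The distance in the maximum norm of two index pairs. -/
def panelDist {N T : ℕ} (p q : Fin N × Fin T) : ℕ :=
  max ((p.1 : ℤ) - (q.1 : ℤ)).natAbs ((p.2 : ℤ) - (q.2 : ℤ)).natAbs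

/-- The sigma field generated by the variables with index in `I`. -/
abbrev panelSigma {Ω : Type*} {N T : ℕ} (e : Ω → Fin N → Fin T → ℝ) (I : Set (Fin N × Fin T)) :
    MeasurableSpace Ω :=
  ⨆ z ∈ I, MeasurableSpace.comap (fun ω => e ω z.1 z.2) inferInstance

/-- The `r`-th strong (alpha) mixing coefficient of the panel `e`. -/
def alphaMixing {Ω : Type*} [MeasurableSpace Ω] (P : Measure Ω) {N T : ℕ}
    (e : Ω → Fin N → Fin T → ℝ) (r : ℕ) : ℝ :=
  sSup {c : ℝ | ∃ I J : Set (Fin N × Fin T), (∀ p ∈ I, ∀ q ∈ J, r ≤ panelDist p q) ∧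
    ∃ A B : Set Ω, MeasurableSet[panelSigma e I] A ∧ MeasurableSet[panelSigma e J] B ∧
      c = |P.real (A ∩ B) - P.real A * P.real B|}

/-- `γ` is the autocovariance function of a (weakly) stationary real process indexed by `ℤ`:
all its finite Toeplitz matrices are symmetric and positive semidefinite. -/
def IsAutocovariance (γ : ℤ → ℝ) : Prop :=
  ∀ m : ℕ, (Matrix.of fun s t : Fin m => γ ((s : ℤ) - (t : ℤ))).PosSemidef

/-! ### The panel model -/

/-- A sequence (triangular array), indexed by `n`, of linear panels with `N n` individuals,
`T n` time points and `K` regressors.  Matrix rows are time points: row `t` of `X n ω i` is the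
regressor vector of individual `i` at time `t`. -/
structure PanelArray (Ω : Type*) [MeasurableSpace Ω] (K : ℕ) where
  /-- cross-sectional dimension -/
  N : ℕ → ℕ
  /-- time dimension -/
  T : ℕ → ℕ
  N_pos : ∀ n, 0 < N n
  T_pos : ∀ n, 0 < T n
  /-- regressor matrices -/
  X : ∀ n, Ω → Fin (N n) → Matrix (Fin (T n)) (Fin K) ℝ
  /-- model errors -/
  ε : ∀ n, Ω → Fin (N n) → Fin (T n) → ℝ
  /-- model errors of the period in which one predicts, time `T n + 1` -/
  εNew : ∀ n, Ω → Fin (N n) → ℝ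
  /-- deterministic regressors of the period in which one predicts -/
  xNew : ∀ n, Fin (N n) → Fin K → ℝ
  /-- deterministic slopes -/
  β : ∀ n, Fin (N n) → Fin K → ℝ
  /-- cross-sectional factor of the error covariance -/
  SigN : ∀ n, Matrix (Fin (N n)) (Fin (N n)) ℝ
  /-- temporal factor of the error covariance -/
  SigT : ∀ n, Matrix (Fin (T n)) (Fin (T n)) ℝ
  measurable_X : ∀ n i t k, Measurable fun ω => X n ω i t k
  measurable_ε : ∀ n i t, Measurable fun ω => ε n ω i t
  measurable_εNew : ∀ n i, Measurable fun ω => εNew n ω i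

namespace PanelArray

variable {Ω : Type*} [MeasurableSpace Ω] {K : ℕ}

/-- All regressors of the `n`-th panel, as one random element. -/
def allX (D : PanelArray Ω K) (n : ℕ) (ω : Ω) : Fin (D.N n) → Fin (D.T n) → Fin K → ℝ :=
  fun i t k => D.X n ω i t k

/-- The responses `y_i = X_i β_i + ε_i`. -/
def y (D : PanelArray Ω K) (n : ℕ) (ω : Ω) (i : Fin (D.N n)) : Fin (D.T n) → ℝ :=
  (D.X n ω i).mulVec (D.β n i) + D.ε n ω i

/-- The Gram matrix `X_i' X_i`. -/
def gram (D : PanelArray Ω K) (n : ℕ) (ω : Ω) (i : Fin (D.N n)) : Matrix (Fin K) (Fin K) ℝ :=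
  (D.X n ω i).transpose * D.X n ω i

/-- The individual OLS estimator `(X_i' X_i)⁻¹ X_i' y_i`. -/
def betaHat (D : PanelArray Ω K) (n : ℕ) (ω : Ω) (i : Fin (D.N n)) : Fin K → ℝ :=
  (D.gram n ω i)⁻¹.mulVec ((D.X n ω i).transpose.mulVec (D.y n ω i))

/-- The residuals `y_i - X_i β̂_i`. -/
def resid (D : PanelArray Ω K) (n : ℕ) (ω : Ω) (i : Fin (D.N n)) : Fin (D.T n) → ℝ :=
  D.y n ω i - (D.X n ω i).mulVec (D.betaHat n ω i)

/-- The estimated lag-`h` autocovariance of individual `i`, with denominator `T - h - K`. -/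
def xiHat (D : PanelArray Ω K) (n : ℕ) (ω : Ω) (i : Fin (D.N n)) (h : ℕ) : ℝ :=
  (∑ t : Fin (D.T n - h), D.resid n ω i ⟨t, by omega⟩ * D.resid n ω i ⟨t + h, by omega⟩) /
    ((D.T n : ℝ) - (h : ℝ) - (K : ℝ))

/-- The banded estimator, with bandwidth `b`, of the error covariance of individual `i`. -/
def SigHat (D : PanelArray Ω K) (n : ℕ) (ω : Ω) (b : ℝ) (i : Fin (D.N n)) :
    Matrix (Fin (D.T n)) (Fin (D.T n)) ℝ :=
  Matrix.of fun s t =>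
    if ((((s : ℤ) - (t : ℤ)).natAbs : ℕ) : ℝ) < b
      then D.xiHat n ω i ((s : ℤ) - (t : ℤ)).natAbs else 0

/-- The matrix `X_i (X_i' X_i)⁻¹ x_{i,T+1} x_{i,T+1}' (X_i' X_i)⁻¹ X_i'`. -/
def predMat (D : PanelArray Ω K) (n : ℕ) (ω : Ω) (i : Fin (D.N n)) :
    Matrix (Fin (D.T n)) (Fin (D.T n)) ℝ :=
  D.X n ω i * (D.gram n ω i)⁻¹ * Matrix.vecMulVec (D.xNew n i) (D.xNew n i) *
    (D.gram n ω i)⁻¹ * (D.X n ω i).transpose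

/-- The variance term `E_1`. -/
def E1 (D : PanelArray Ω K) (n : ℕ) (ω : Ω) : ℝ :=
  (D.SigT n * ∑ i, ((1 / (D.N n : ℝ)) * D.SigN n i i) • D.predMat n ω i).trace

/-- The banded plug-in estimator of `E_1`, with bandwidth `b`. -/
def E1Hat (D : PanelArray Ω K) (n : ℕ) (b : ℝ) (ω : Ω) : ℝ :=
  (1 / (D.N n : ℝ)) * ∑ i, (D.SigHat n ω b i * D.predMat n ω i).trace

/-! ### Assumptions -/

/-- Moments, separable error covariance, exogeneity, and the errors of the prediction period. -/
structure BasicAssumptions (D : PanelArray Ω K) (P : Measure Ω) (M : ℕ) : Prop where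
  moments : ∃ C : ℝ, 0 < C ∧
    (∀ n i t, Integrable (fun ω => |D.ε n ω i t| ^ M) P ∧ ∫ ω, |D.ε n ω i t| ^ M ∂P ≤ C) ∧
    (∀ n i t, Integrable (fun ω => euclNorm (D.X n ω i t) ^ M) P ∧
      ∫ ω, euclNorm (D.X n ω i t) ^ M ∂P ≤ C)
  centered : ∀ n i t, ∫ ω, D.ε n ω i t ∂P = 0
  sigN_posSemidef : ∀ n, (D.SigN n).PosSemidef
  sigT_stationary : ∀ n, ∃ γ : ℤ → ℝ, IsAutocovariance γ ∧
    ∀ s t, D.SigT n s t = γ ((s : ℤ) - (t : ℤ))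
  covariance_eq : ∀ n (p q : Fin (D.N n) × Fin (D.T n)),
    cov[fun ω => D.ε n ω p.1 p.2, fun ω => D.ε n ω q.1 q.2; P] = (D.SigN n ⊗ₖ D.SigT n) p q
  exogeneity : ∀ n, IndepFun (D.ε n) (D.allX n) P
  new_indep : ∀ n, IndepFun (D.εNew n) (fun ω => (D.ε n ω, D.allX n ω)) P
  new_memLp : ∀ n i, MemLp (fun ω => D.εNew n ω i) 2 P
  new_centered : ∀ n i, ∫ ω, D.εNew n ω i ∂P = 0
  new_covariance : ∀ n i j, cov[fun ω => D.εNew n ω i, fun ω => D.εNew n ω j; P] =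
    D.SigT n ⟨0, D.T_pos n⟩ ⟨0, D.T_pos n⟩ * D.SigN n i j

/-- Uniform convergence in probability of `X_i' X_i / T` to uniformly bounded, uniformly positive
definite matrices. -/
def RegressorConvergence (D : PanelArray Ω K) (P : Measure Ω) : Prop :=
  ∃ (Q : ∀ n, Fin (D.N n) → Matrix (Fin K) (Fin K) ℝ) (c₁ c₂ : ℝ) (hQ : ∀ n i, (Q n i).PosDef),
    0 < c₁ ∧ (∀ n i k, c₁ ≤ (hQ n i).isHermitian.eigenvalues k) ∧
    (∀ n i, frobNorm (Q n i) ≤ c₂) ∧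
    ∀ δ : ℝ, 0 < δ →
      Tendsto (fun n => P {ω | ∃ i, δ < frobNorm ((1 / (D.T n : ℝ)) • D.gram n ω i - Q n i)})
        atTop (𝓝 0)

/-- Uniform boundedness of the vectors `x_{i,T+1}`. -/
def BoundedPredictors (D : PanelArray Ω K) : Prop :=
  ∃ c₃ : ℝ, 0 < c₃ ∧ ∀ n i, euclNorm (D.xNew n i) ≤ c₃

/-- Exponentially decaying mixing coefficients of the errors. -/
def ExpMixing (D : PanelArray Ω K) (P : Measure Ω) : Prop :=
  ∃ (ψ : ℝ) (r₀ : ℕ), 1 < ψ ∧ ∀ n r, r₀ ≤ r → alphaMixing P (D.ε n) r ≤ ψ ^ (-(r : ℝ))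

/-- Polynomially decaying mixing coefficients of the errors, with exponent `a`. -/
def PolyMixing (D : PanelArray Ω K) (P : Measure Ω) (a : ℝ) : Prop :=
  ∃ C : ℝ, 0 < C ∧ ∀ n (r : ℕ), 1 ≤ r → alphaMixing P (D.ε n) r ≤ C * (r : ℝ) ^ (-a)

/-- Uniformly bounded slopes. -/
def BoundedSlopes (D : PanelArray Ω K) : Prop :=
  ∃ c₄ : ℝ, 0 < c₄ ∧ ∀ n i, euclNorm (D.β n i) ≤ c₄

/-- Moderate heterogeneity of the slopes. -/
def ModerateHeterogeneity (D : PanelArray Ω K) : Prop :=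
  ∃ c₅ : ℝ, 0 < c₅ ∧ ∀ n i j, euclNorm (D.β n i - D.β n j) ≤ c₅ / √(D.T n : ℝ)

/-- The rate `b / T² + b^{7/4} / (√N T^{3/2})`. -/
def rate (D : PanelArray Ω K) (b : ℕ → ℝ) (n : ℕ) : ℝ :=
  b n / (D.T n : ℝ) ^ 2 +
    b n ^ (7 / 4 : ℝ) / (√(D.N n : ℝ) * (D.T n : ℝ) ^ (3 / 2 : ℝ))

/-- The rate under polynomial mixing, with the additional term `b^{-a (1 - 2 / M) + 1} / T`. -/
def polyRate (D : PanelArray Ω K) (M : ℕ) (a : ℝ) (b : ℕ → ℝ) (n : ℕ) : ℝ :=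
  D.rate b n + b n ^ (-a * (1 - 2 / (M : ℝ)) + 1) / (D.T n : ℝ)

/-- The target order `1 / (√N T)`. -/
def targetRate (D : PanelArray Ω K) (n : ℕ) : ℝ :=
  1 / (√(D.N n : ℝ) * (D.T n : ℝ))

end PanelArray

end

/-! Put `w_i = X_i (X_i'X_i)⁻¹ x_{i,T+1}`. Estimator and target are averages of quadratic forms
`w_i' Σ w_i` with Toeplitz `Σ`. Hence their difference is the average over `i` of sums over lags `h`
of a weight times the error in the `h`-th autocovariance, and each weight is at most `2 |w_i|²`
(`abs_lagWeight_le`). When all `X_i'X_i / T` are within `c₁/2` of `Q_i`, an event of probability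
tending to one, `|w_i|² = O(1/T)`.

The error then has three sources (`abs_plugInError_sub_le`). Lags `h ≥ b` are dropped, which costs
`τ/T` with `τ` a tail sum of autocovariances. The denominators `T - h - K` and the use of residuals
in place of errors cost `O(1/T)` per lag in mean, so `O(b/T²)` in total. What remains is a centered
sum of products `ε_s ε_t` over the band, with coefficients `O(T⁻²)`. Covariances of such products
decay both in the cross-sectional distance and in the distance between the two pairs of times.
Summing over the `O(N T b)` products and, for each, its `O(b)` effective partners gives the second
moment `O(b² / (N T³))` (`PanelMoments.main_bound`), and `b ≤ b^{7/4}` leads to the stated rate.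

The decay comes from a truncated Davydov inequality (`abs_cov_le_of_mixing`): with `p` moments,
truncation at level `c` costs `c^{2-p}`. Products of errors have `8` moments since `M ≥ 16`, and `c
= 1 + d` at distance `d` is enough for summability. For single errors, `p = M` with a level tuned to
the mixing rate gives the sharper decay behind `τ`.

Conditioning is harmless. Errors and regressors are independent, so bounds for fixed regressors
integrate to unconditional tail bounds (`measure_le_of_indepFun`), and these suffice because `P(P(E
| X) > δ) ≤ P(E) / δ` (`measure_condProb_gt_le`). -/

/-! ### Covariance inequality for strongly mixing sigma fields -/

section Mixing

variable {Ω : Type*} {m0 : MeasurableSpace Ω} {P : Measure Ω} [IsProbabilityMeasure P]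

/-- A bounded measurable factor costs at most twice its bound when integrals over the events of
its sigma field are small. -/
theorem abs_integral_mul_le_of_setIntegral_le {𝒜 : MeasurableSpace Ω} (h𝒜 : 𝒜 ≤ m0)
    {U W : Ω → ℝ} {c κ : ℝ} (hU : Measurable[𝒜] U) (hUc : ∀ ω, |U ω| ≤ c) (hc : 0 ≤ c)
    (hW : Integrable W P) (hκ : ∀ A, MeasurableSet[𝒜] A → |∫ ω in A, W ω ∂P| ≤ κ) :
    |∫ ω, U ω * W ω ∂P| ≤ 2 * c * κ := by
  set E : Ω → ℝ := P[W|𝒜] with hE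
  have hEm : Measurable[𝒜] E := stronglyMeasurable_condExp.measurable
  have hEi : Integrable E P := integrable_condExp
  have h1 : ∫ ω, U ω * W ω ∂P = ∫ ω, U ω * E ω ∂P := by
    have h := condExp_stronglyMeasurable_mul_of_bound h𝒜 hU.stronglyMeasurable hW c
      (Eventually.of_forall fun ω => by simpa using hUc ω)
    have h2 := integral_condExp (μ := P) (f := U * W) h𝒜
    rw [integral_congr_ae h] at h2
    simpa using h2.symm
  have hAm : MeasurableSet[𝒜] {ω | 0 ≤ E ω} := measurableSet_le measurable_const hEm
  have hAm' : MeasurableSet[𝒜] {ω | 0 ≤ E ω}ᶜ := hAm.compl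
  -- The sign of `E` splits the space into two events of `𝒜`. On each of them the integral of `|E|`
  -- is a set integral of `W` up to sign; this is the factor `2`.
  have h3 : ∫ ω, |E ω| ∂P = (∫ ω in {ω | 0 ≤ E ω}, W ω ∂P) - ∫ ω in {ω | 0 ≤ E ω}ᶜ, W ω ∂P := by
    rw [← setIntegral_condExp h𝒜 hW hAm, ← setIntegral_condExp h𝒜 hW hAm',
      ← integral_add_compl (h𝒜 _ hAm) hEi.abs]
    have e1 : ∫ ω in {ω | 0 ≤ E ω}, |E ω| ∂P = ∫ ω in {ω | 0 ≤ E ω}, E ω ∂P :=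
      setIntegral_congr_fun (h𝒜 _ hAm) fun ω hω => abs_of_nonneg hω
    have e2 : ∫ ω in {ω | 0 ≤ E ω}ᶜ, |E ω| ∂P = ∫ ω in {ω | 0 ≤ E ω}ᶜ, -E ω ∂P :=
      setIntegral_congr_fun (h𝒜 _ hAm') fun ω hω => abs_of_neg (by simpa using hω)
    rw [e1, e2, integral_neg]
    ring
  rw [h1]
  calc |∫ ω, U ω * E ω ∂P| ≤ ∫ ω, |U ω * E ω| ∂P := abs_integral_le_integral_abs
    _ ≤ ∫ ω, c * |E ω| ∂P := by
        refine integral_mono_of_nonneg (Eventually.of_forall fun _ => abs_nonneg _)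
          (hEi.abs.const_mul c) (Eventually.of_forall fun ω => ?_)
        simp only [abs_mul]
        exact mul_le_mul_of_nonneg_right (hUc ω) (abs_nonneg _)
    _ = c * ∫ ω, |E ω| ∂P := integral_const_mul _ _
    _ ≤ c * (κ + κ) := by
        refine mul_le_mul_of_nonneg_left ?_ hc
        have a1 := (abs_le.1 (hκ _ hAm)).2
        have a2 := (abs_le.1 (hκ _ hAm')).1
        rw [h3]
        linarith
    _ = 2 * c * κ := by ring

/-- Covariances of bounded variables under mixing. -/
theorem abs_cov_le_of_bounded {𝒜 ℬ : MeasurableSpace Ω} (h𝒜 : 𝒜 ≤ m0) (hℬ : ℬ ≤ m0)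
    {α : ℝ} (hα : ∀ A B, MeasurableSet[𝒜] A → MeasurableSet[ℬ] B →
      |P.real (A ∩ B) - P.real A * P.real B| ≤ α)
    {U V : Ω → ℝ} {c : ℝ} (hc : 0 ≤ c) (hU : Measurable[𝒜] U) (hV : Measurable[ℬ] V)
    (hUc : ∀ ω, |U ω| ≤ c) (hVc : ∀ ω, |V ω| ≤ c) :
    |∫ ω, U ω * V ω ∂P - (∫ ω, U ω ∂P) * ∫ ω, V ω ∂P| ≤ 4 * α * c ^ 2 := by
  have hUi : Integrable U P := Integrable.of_bound (hU.mono h𝒜 le_rfl).aestronglyMeasurable c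
    (Eventually.of_forall fun ω => by simpa using hUc ω)
  have hVi : Integrable V P := Integrable.of_bound (hV.mono hℬ le_rfl).aestronglyMeasurable c
    (Eventually.of_forall fun ω => by simpa using hVc ω)
  have hUV : Integrable (fun ω => U ω * V ω) P :=
    hVi.bdd_mul (c := c) (hU.mono h𝒜 le_rfl).aestronglyMeasurable
      (Eventually.of_forall fun ω => by simpa using hUc ω)
  -- The previous bound is used twice: here for `V` against the centered indicator of `A`, with `κ =
  -- α`, and at the end for `U` against the centered `V`, with `κ = 2cα`. Together they give `4αc²`.
  have key : ∀ A, MeasurableSet[𝒜] A → |∫ ω in A, (V ω - ∫ ω, V ω ∂P) ∂P| ≤ 2 * c * α := by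
    intro A hA
    have hA' := h𝒜 A hA
    have hind : Integrable (A.indicator fun _ => (1 : ℝ)) P :=
      (integrable_const 1).indicator hA'
    have e1 : ∫ ω in A, (V ω - ∫ ω, V ω ∂P) ∂P
        = ∫ ω, V ω * (A.indicator (fun _ => (1 : ℝ)) ω - P.real A) ∂P := by
      rw [integral_sub hVi.integrableOn (integrable_const _), ← integral_indicator hA']
      have : ∀ ω, V ω * (A.indicator (fun _ => (1 : ℝ)) ω - P.real A)
          = A.indicator V ω - P.real A * V ω := by
        intro ω
        by_cases h : ω ∈ A <;> simp [h] <;> ring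
      simp_rw [this]
      rw [integral_sub (hVi.indicator hA') (hVi.const_mul _), integral_const_mul]
      simp
    rw [e1]
    refine abs_integral_mul_le_of_setIntegral_le hℬ hV hVc hc (hind.sub (integrable_const _)) ?_
    intro B hB
    have hB' := hℬ B hB
    have e2 : ∫ ω in B, (A.indicator (fun _ => (1 : ℝ)) ω - P.real A) ∂P
        = P.real (A ∩ B) - P.real A * P.real B := by
      rw [integral_sub hind.integrableOn (integrable_const _), integral_indicator hA',
        Measure.restrict_restrict hA']
      simp [mul_comm]
    rw [e2]
    exact hα A B hA hB
  have e3 : ∫ ω, U ω * V ω ∂P - (∫ ω, U ω ∂P) * ∫ ω, V ω ∂P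
      = ∫ ω, U ω * (V ω - ∫ ω, V ω ∂P) ∂P := by
    simp_rw [mul_sub]
    rw [integral_sub hUV (hUi.mul_const _), integral_mul_const]
  rw [e3]
  refine (abs_integral_mul_le_of_setIntegral_le h𝒜 hU hUc hc (hVi.sub (integrable_const _))
    key).trans (le_of_eq (by ring))

/-- A truncated version of Davydov's covariance inequality. -/
theorem abs_cov_le_of_mixing {𝒜 ℬ : MeasurableSpace Ω} (h𝒜 : 𝒜 ≤ m0) (hℬ : ℬ ≤ m0)
    {α : ℝ} (hα : ∀ A B, MeasurableSet[𝒜] A → MeasurableSet[ℬ] B →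
      |P.real (A ∩ B) - P.real A * P.real B| ≤ α)
    {U V : Ω → ℝ} (hU : Measurable[𝒜] U) (hV : Measurable[ℬ] V) {p : ℕ} (hp : 2 ≤ p) {B C c : ℝ}
    (hUi : Integrable (fun ω => |U ω| ^ p) P) (hUB : ∫ ω, |U ω| ^ p ∂P ≤ B)
    (hVi : Integrable (fun ω => |V ω| ^ p) P) (hVB : ∫ ω, |V ω| ^ p ∂P ≤ B)
    (hc : 1 ≤ c) (hαc : α * c ^ p ≤ C) :
    |∫ ω, U ω * V ω ∂P - (∫ ω, U ω ∂P) * ∫ ω, V ω ∂P|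
      ≤ (4 * C + 2 * B + 2 * B * (1 + B)) * (c ^ 2 / c ^ p) := by
  have hc0 : 0 < c := by linarith
  have hcp : 0 < c ^ p := by positivity
  have hUm := hU.mono h𝒜 le_rfl
  have hVm := hV.mono hℬ le_rfl
  have hB0 : 0 ≤ B := le_trans (integral_nonneg fun _ => by positivity) hUB
  have hpow1 : ∀ x : ℝ, |x| ≤ 1 + |x| ^ p := by
    intro x
    rcases le_total |x| 1 with h | h
    · have : 0 ≤ |x| ^ p := by positivity
      linarith
    · have := le_self_pow₀ h (by omega : p ≠ 0)
      linarith
  -- Above the level `c`, the surplus power `x^{p-2}` is at least `c^{p-2}`. The quotient `c² / c^p`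
  -- avoids subtraction in the exponent.
  have hbig : ∀ x : ℝ, c < x → x ^ 2 ≤ c ^ 2 / c ^ p * x ^ p := by
    intro x hx
    obtain ⟨q, rfl⟩ := Nat.exists_eq_add_of_le hp
    rw [pow_add, pow_add, div_mul_eq_mul_div, le_div_iff₀ (by positivity)]
    have : c ^ q ≤ x ^ q := pow_le_pow_left₀ hc0.le hx.le q
    have h2 : 0 ≤ x ^ 2 * c ^ 2 := by positivity
    nlinarith
  have hInt : ∀ W : Ω → ℝ, Measurable[m0] W → Integrable (fun ω => |W ω| ^ p) P → Integrable W P := by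
    intro W hW hi
    refine Integrable.mono' ((integrable_const 1).add hi) hW.aestronglyMeasurable
      (Eventually.of_forall fun ω => ?_)
    simpa using hpow1 (W ω)
  have hUint := hInt U hUm hUi
  have hVint := hInt V hVm hVi
  set τ : ℝ → ℝ := fun x => if |x| ≤ c then x else 0 with hτ
  have hτm : Measurable τ :=
    Measurable.ite (measurableSet_le measurable_id.abs measurable_const) measurable_id
      measurable_const
  have hτc : ∀ x, |τ x| ≤ c := by
    intro x
    simp only [hτ]
    split_ifs with h
    · exact h
    · simpa using hc0.le
  have hτle : ∀ x, |τ x| ≤ |x| := by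
    intro x
    simp only [hτ]
    split_ifs with h
    · exact le_rfl
    · simp
  have hτsub : ∀ x, |x - τ x| ≤ c ^ 2 / c ^ p * |x| ^ p := by
    intro x
    simp only [hτ]
    split_ifs with h
    · simp only [sub_self, abs_zero]; positivity
    · push Not at h
      have := hbig |x| h
      rw [sub_zero]
      nlinarith [abs_nonneg x]
  have hprod : ∀ x y, |x * y - τ x * τ y| ≤ c ^ 2 / c ^ p * (|x| ^ p + |y| ^ p) := by
    intro x y
    have hx0 : 0 ≤ c ^ 2 / c ^ p * |x| ^ p := by positivity
    have hy0 : 0 ≤ c ^ 2 / c ^ p * |y| ^ p := by positivity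
    by_cases h : |x| ≤ c ∧ |y| ≤ c
    · simp only [hτ, if_pos h.1, if_pos h.2, sub_self, abs_zero]
      positivity
    -- Values above the level are set to zero rather than clipped, so the truncated product vanishes
    -- here. The error `|x y|` is then at most the square of the larger factor, which exceeds `c`.
    · have e : τ x * τ y = 0 := by
        by_cases h1 : |x| ≤ c
        · have h2 : ¬ |y| ≤ c := fun h2 => h ⟨h1, h2⟩
          simp [hτ, h2]
        · simp [hτ, h1]
      rw [e, sub_zero, abs_mul, mul_add]
      have hax := abs_nonneg x
      have hay := abs_nonneg y
      rcases le_total |x| |y| with hxy | hxy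
      · have : c < |y| := by
          by_contra! h3
          exact h ⟨hxy.trans h3, h3⟩
        have := hbig _ this
        nlinarith
      · have : c < |x| := by
          by_contra! h3
          exact h ⟨h3, hxy.trans h3⟩
        have := hbig _ this
        nlinarith
  set U₁ := fun ω => τ (U ω) with hU₁
  set V₁ := fun ω => τ (V ω) with hV₁
  have hU₁m : Measurable[𝒜] U₁ := hτm.comp hU
  have hV₁m : Measurable[ℬ] V₁ := hτm.comp hV
  have hU₁i : Integrable U₁ P := Integrable.mono hUint
    (hU₁m.mono h𝒜 le_rfl).aestronglyMeasurable (Eventually.of_forall fun ω => by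
      simpa using hτle (U ω))
  have hV₁i : Integrable V₁ P := Integrable.mono hVint
    (hV₁m.mono hℬ le_rfl).aestronglyMeasurable (Eventually.of_forall fun ω => by
      simpa using hτle (V ω))
  have hU₁V₁ : Integrable (fun ω => U₁ ω * V₁ ω) P :=
    hV₁i.bdd_mul (c := c) (hU₁m.mono h𝒜 le_rfl).aestronglyMeasurable
      (Eventually.of_forall fun ω => by simpa using hτc (U ω))
  have hUV : Integrable (fun ω => U ω * V ω) P := by
    have hd : Integrable (fun ω => U ω * V ω - U₁ ω * V₁ ω) P := by
      refine Integrable.mono' ((hUi.add hVi).const_mul (c ^ 2 / c ^ p)) ?_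
        (Eventually.of_forall fun ω => by simpa using hprod (U ω) (V ω))
      exact (hUm.mul hVm).aestronglyMeasurable.sub hU₁V₁.aestronglyMeasurable
    have := hd.add hU₁V₁
    refine this.congr (Eventually.of_forall fun ω => ?_)
    simp
  have b1 := abs_cov_le_of_bounded h𝒜 hℬ hα hc0.le hU₁m hV₁m (fun ω => hτc (U ω))
    (fun ω => hτc (V ω))
  have b2 : |∫ ω, U ω * V ω ∂P - ∫ ω, U₁ ω * V₁ ω ∂P| ≤ c ^ 2 / c ^ p * (B + B) := by
    rw [← integral_sub hUV hU₁V₁]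
    refine abs_integral_le_integral_abs.trans ?_
    calc ∫ ω, |U ω * V ω - U₁ ω * V₁ ω| ∂P
        ≤ ∫ ω, c ^ 2 / c ^ p * (|U ω| ^ p + |V ω| ^ p) ∂P :=
          integral_mono_of_nonneg (Eventually.of_forall fun _ => abs_nonneg _)
            ((hUi.add hVi).const_mul _) (Eventually.of_forall fun ω => hprod (U ω) (V ω))
      _ = c ^ 2 / c ^ p * (∫ ω, |U ω| ^ p ∂P + ∫ ω, |V ω| ^ p ∂P) := by
          rw [integral_const_mul, integral_add hUi hVi]
      _ ≤ _ := by gcongr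
  have b3 : ∀ W : Ω → ℝ, Measurable[m0] W → Integrable (fun ω => |W ω| ^ p) P →
      ∫ ω, |W ω| ^ p ∂P ≤ B → Integrable (fun ω => τ (W ω)) P →
      |∫ ω, W ω ∂P - ∫ ω, τ (W ω) ∂P| ≤ c ^ 2 / c ^ p * B := by
    intro W hW hi hb ht
    rw [← integral_sub (hInt W hW hi) ht]
    refine abs_integral_le_integral_abs.trans ?_
    calc ∫ ω, |W ω - τ (W ω)| ∂P ≤ ∫ ω, c ^ 2 / c ^ p * |W ω| ^ p ∂P :=
          integral_mono_of_nonneg (Eventually.of_forall fun _ => abs_nonneg _)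
            (hi.const_mul _) (Eventually.of_forall fun ω => hτsub (W ω))
      _ = c ^ 2 / c ^ p * ∫ ω, |W ω| ^ p ∂P := integral_const_mul _ _
      _ ≤ _ := by gcongr
  have b4 : ∀ W : Ω → ℝ, Integrable W P → (∀ ω, |W ω| ≤ 1 + |V ω| ^ p) ∨
      (∀ ω, |W ω| ≤ 1 + |U ω| ^ p) → |∫ ω, W ω ∂P| ≤ 1 + B := by
    intro W hW h
    refine abs_integral_le_integral_abs.trans ?_
    rcases h with h | h
    · calc ∫ ω, |W ω| ∂P ≤ ∫ ω, (1 + |V ω| ^ p) ∂P :=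
            integral_mono hW.abs ((integrable_const 1).add hVi) h
        _ = 1 + ∫ ω, |V ω| ^ p ∂P := by
            rw [integral_add (integrable_const 1) hVi]; simp
        _ ≤ _ := by gcongr
    · calc ∫ ω, |W ω| ∂P ≤ ∫ ω, (1 + |U ω| ^ p) ∂P :=
            integral_mono hW.abs ((integrable_const 1).add hUi) h
        _ = 1 + ∫ ω, |U ω| ^ p ∂P := by
            rw [integral_add (integrable_const 1) hUi]; simp
        _ ≤ _ := by gcongr
  have b5 := b4 V hVint (Or.inl fun ω => hpow1 _)
  have b6 := b4 U₁ hU₁i (Or.inr fun ω => (hτle _).trans (hpow1 _))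
  have b7 := b3 U hUm hUi hUB hU₁i
  have b8 := b3 V hVm hVi hVB hV₁i
  set r := c ^ 2 / c ^ p with hr
  have hr0 : 0 ≤ r := by positivity
  -- The condition `α c^p ≤ C` puts the covariance of the truncated variables on the scale `c² /
  -- c^p` of the truncation errors.
  have b9 : 4 * α * c ^ 2 ≤ 4 * C * r := by
    have : α * c ^ 2 = (α * c ^ p) * r := by
      rw [hr]; field_simp
    nlinarith
  have b10 : |(∫ ω, U ω ∂P) * ∫ ω, V ω ∂P - (∫ ω, U₁ ω ∂P) * ∫ ω, V₁ ω ∂P|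
      ≤ 2 * B * (1 + B) * r := by
    have e : (∫ ω, U ω ∂P) * ∫ ω, V ω ∂P - (∫ ω, U₁ ω ∂P) * ∫ ω, V₁ ω ∂P
        = (∫ ω, U ω ∂P - ∫ ω, U₁ ω ∂P) * ∫ ω, V ω ∂P
          + (∫ ω, U₁ ω ∂P) * (∫ ω, V ω ∂P - ∫ ω, V₁ ω ∂P) := by ring
    rw [e]
    refine (abs_add_le _ _).trans ?_
    rw [abs_mul, abs_mul]
    have m1 := mul_le_mul b7 b5 (abs_nonneg _) (by positivity)
    have m2 := mul_le_mul b6 b8 (abs_nonneg _) (by positivity)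
    simp only [hU₁, hV₁] at m1 m2 ⊢
    linarith
  have t1 := abs_le.1 b1
  have t2 := abs_le.1 b2
  have t3 := abs_le.1 b10
  rw [abs_le]
  constructor <;> nlinarith [t1.1, t1.2, t2.1, t2.2, t3.1, t3.2, b9]

end Mixing

/-! ### Ordinary least squares with a well-conditioned Gram matrix -/

section OLS

open Matrix

variable {T K : ℕ}

/-- The row vector of prediction weights `X (X'X)⁻¹ z`. -/
noncomputable def olsWeight (x : Matrix (Fin T) (Fin K) ℝ) (z : Fin K → ℝ) : Fin T → ℝ :=
  x *ᵥ ((xᵀ * x)⁻¹ *ᵥ z)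

/-- The least squares residuals of `e`. -/
noncomputable def olsResid (x : Matrix (Fin T) (Fin K) ℝ) (e : Fin T → ℝ) : Fin T → ℝ :=
  e - olsWeight x (xᵀ *ᵥ e)

/-- The Gram matrix `X'X` is at least `c T` and its trace is at most `C T`. -/
structure GramBounds (x : Matrix (Fin T) (Fin K) ℝ) (c C : ℝ) : Prop where
  lower : ∀ v : Fin K → ℝ, c * T * (v ⬝ᵥ v) ≤ v ⬝ᵥ ((xᵀ * x) *ᵥ v)
  upper : ∑ k, ∑ t, x t k ^ 2 ≤ C * T

theorem dotProduct_self_nonneg' {n : ℕ} (v : Fin n → ℝ) : 0 ≤ v ⬝ᵥ v :=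
  Finset.sum_nonneg fun _ _ => mul_self_nonneg _

/-- Young's inequality. Below, the weight is of order `T`, which balances the slope error against
the cross moments. -/
theorem dotProduct_le_half {n : ℕ} (u v : Fin n → ℝ) {a : ℝ} (ha : 0 < a) :
    u ⬝ᵥ v ≤ a / 2 * (u ⬝ᵥ u) + (v ⬝ᵥ v) / (2 * a) := by
  simp only [dotProduct, Finset.mul_sum, Finset.sum_div, ← Finset.sum_add_distrib]
  refine Finset.sum_le_sum fun i _ => ?_
  have h : a / 2 * (u i * u i) + v i * v i / (2 * a) - u i * v i
      = (a * u i - v i) ^ 2 / (2 * a) := by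
    field_simp; ring
  have : 0 ≤ (a * u i - v i) ^ 2 / (2 * a) := by positivity
  linarith

theorem abs_dotProduct_le_half {n : ℕ} (u v : Fin n → ℝ) {a : ℝ} (ha : 0 < a) :
    |u ⬝ᵥ v| ≤ a / 2 * (u ⬝ᵥ u) + (v ⬝ᵥ v) / (2 * a) := by
  rw [abs_le']
  refine ⟨dotProduct_le_half u v ha, ?_⟩
  have := dotProduct_le_half (-u) v ha
  simpa using this

theorem dotProduct_mulVec_self (x : Matrix (Fin T) (Fin K) ℝ) (u : Fin K → ℝ) :
    (x *ᵥ u) ⬝ᵥ (x *ᵥ u) = u ⬝ᵥ ((xᵀ * x) *ᵥ u) := by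
  rw [← mulVec_mulVec, dotProduct_mulVec u, vecMul_transpose]

namespace GramBounds

variable {x : Matrix (Fin T) (Fin K) ℝ} {c C : ℝ}

theorem isUnit_det (h : GramBounds x c C) (hc : 0 < c) (hT : 0 < T) :
    IsUnit (xᵀ * x).det := by
  have hpos : (xᵀ * x).PosDef := by
    refine PosDef.of_dotProduct_mulVec_pos ?_ fun v hv => ?_
    · simpa using isHermitian_conjTranspose_mul_self x
    · have hv' : 0 < v ⬝ᵥ v := by
        rcases (dotProduct_self_nonneg' v).lt_or_eq with h1 | h1
        · exact h1
        · exact absurd (dotProduct_self_eq_zero.1 h1.symm) hv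
      have hT' : (0 : ℝ) < T := by exact_mod_cast hT
      have := h.lower v
      simp only [star_trivial]
      exact lt_of_lt_of_le (by positivity) this
  exact (isUnit_iff_ne_zero.2 hpos.det_pos.ne')

theorem gram_mulVec_inv (h : GramBounds x c C) (hc : 0 < c) (hT : 0 < T) (q : Fin K → ℝ) :
    (xᵀ * x) *ᵥ ((xᵀ * x)⁻¹ *ᵥ q) = q := by
  rw [mulVec_mulVec, mul_nonsing_inv _ (h.isUnit_det hc hT), one_mulVec]

theorem inv_mulVec_gram (h : GramBounds x c C) (hc : 0 < c) (hT : 0 < T) (q : Fin K → ℝ) :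
    (xᵀ * x)⁻¹ *ᵥ ((xᵀ * x) *ᵥ q) = q := by
  rw [mulVec_mulVec, nonsing_inv_mul _ (h.isUnit_det hc hT), one_mulVec]

/-- For `u = (X'X)⁻¹ q` the lower Gram bound reads `c T |u|² ≤ u · q`. Young's inequality with
weight `c T` absorbs half of the left side. -/
theorem inv_mulVec_sq_le (h : GramBounds x c C) (hc : 0 < c) (hT : 0 < T) (q : Fin K → ℝ) :
    ((xᵀ * x)⁻¹ *ᵥ q) ⬝ᵥ ((xᵀ * x)⁻¹ *ᵥ q) ≤ (q ⬝ᵥ q) / (c * T) ^ 2 := by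
  have hT' : (0 : ℝ) < T := by exact_mod_cast hT
  have h1 := h.lower ((xᵀ * x)⁻¹ *ᵥ q)
  rw [h.gram_mulVec_inv hc hT] at h1
  have h2 := dotProduct_le_half ((xᵀ * x)⁻¹ *ᵥ q) q (a := c * T) (by positivity)
  set A := ((xᵀ * x)⁻¹ *ᵥ q) ⬝ᵥ ((xᵀ * x)⁻¹ *ᵥ q)
  have h3 : c * T / 2 * A ≤ q ⬝ᵥ q / (2 * (c * T)) := by linarith
  rw [le_div_iff₀ (by positivity)] at h3 ⊢
  linarith

/-- For `u = (X'X)⁻¹ q` one has `|X u|² = u · q`, which Young's inequality bounds through `|u|²`.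
For bounded `q` this is the order `1/T` of the squared prediction weights, which scales every later
estimate. -/
theorem olsWeight_sq_le (h : GramBounds x c C) (hc : 0 < c) (hT : 0 < T) (q : Fin K → ℝ) :
    olsWeight x q ⬝ᵥ olsWeight x q ≤ (q ⬝ᵥ q) / (c * T) := by
  have hT' : (0 : ℝ) < T := by exact_mod_cast hT
  have h0 := h.inv_mulVec_sq_le hc hT q
  have h2 := dotProduct_le_half ((xᵀ * x)⁻¹ *ᵥ q) q (a := c * T) (by positivity)
  rw [olsWeight, dotProduct_mulVec_self, h.gram_mulVec_inv hc hT]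
  have h3 : c * T / 2 * (q ⬝ᵥ q / (c * T) ^ 2) + q ⬝ᵥ q / (2 * (c * T)) = q ⬝ᵥ q / (c * T) := by
    field_simp; ring
  have h4 : c * T / 2 * (((xᵀ * x)⁻¹ *ᵥ q) ⬝ᵥ ((xᵀ * x)⁻¹ *ᵥ q))
      ≤ c * T / 2 * (q ⬝ᵥ q / (c * T) ^ 2) := by gcongr
  linarith

end GramBounds

end OLS

/-! ### Lags -/

section Lags

variable {T : ℕ}

/-- Absolute lag of two time points. -/
def lag (s t : Fin T) : ℕ := ((s : ℤ) - (t : ℤ)).natAbs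

theorem lag_lt (s t : Fin T) : lag s t < T := by
  simp only [lag]; omega

/-- Trades the lag-dependent index type `Fin (T - h)` for pairs in `Fin T`, so that sums over lags
and over times can be exchanged. For `h ≥ T` both sides are empty sums. -/
theorem sum_fin_sub_eq (h : ℕ) (F : Fin T → Fin T → ℝ) :
    ∑ t : Fin (T - h), F ⟨t, by omega⟩ ⟨t + h, by omega⟩
      = ∑ s : Fin T, ∑ t : Fin T, if (t : ℕ) = s + h then F s t else 0 := by
  rw [← Fintype.sum_prod_type']
  refine Finset.sum_of_injOn
    (fun t : Fin (T - h) => ((⟨t, by omega⟩, ⟨t + h, by omega⟩) : Fin T × Fin T)) ?_ ?_ ?_ ?_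
  · intro a _ b _ hab
    simp only [Prod.mk.injEq, Fin.mk.injEq] at hab
    exact Fin.ext hab.1
  · intro a _
    simp
  · rintro ⟨s, t⟩ _ hst
    simp only
    rw [if_neg]
    intro ht
    apply hst
    refine ⟨⟨s, by omega⟩, by simp, ?_⟩
    ext <;> simp [ht]
  · intro a _
    simp

/-- The weighted sum of a function over all pairs of time points with lag `h`. -/
noncomputable def lagWeight (w : Fin T → ℝ) (h : ℕ) : ℝ :=
  ∑ s, ∑ t, if lag s t = h then w t * w s else 0

/-- Groups a Toeplitz quadratic form by diagonals, which reduces the estimation error to errors of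
single autocovariances. -/
theorem sum_sum_lag_eq (w : Fin T → ℝ) (f : ℕ → ℝ) :
    ∑ s, ∑ t, f (lag s t) * (w t * w s) = ∑ h ∈ Finset.range T, lagWeight w h * f h := by
  simp only [lagWeight, Finset.sum_mul]
  rw [Finset.sum_comm]
  conv_rhs => rw [Finset.sum_comm]
  rw [Finset.sum_comm]
  refine Finset.sum_congr rfl fun s _ => ?_
  rw [Finset.sum_comm]
  refine Finset.sum_congr rfl fun t _ => ?_
  rw [Finset.sum_eq_single_of_mem (lag s t) (Finset.mem_range.2 (lag_lt s t))]
  · rw [if_pos rfl]; ring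
  · intro b _ hb
    rw [if_neg (Ne.symm hb), zero_mul]

theorem card_lag_eq_le (s : Fin T) (h : ℕ) :
    (Finset.univ.filter fun t : Fin T => lag s t = h).card ≤ 2 := by
  have : (Finset.univ.filter fun t : Fin T => lag s t = h).card
      ≤ ({(s : ℤ) + h, (s : ℤ) - h} : Finset ℤ).card := by
    refine Finset.card_le_card_of_injOn (fun t : Fin T => (t : ℤ)) ?_ ?_
    · intro t ht
      have ht' : lag s t = h := (Finset.mem_filter.1 ht).2
      simp only [lag] at ht'
      simp only [Finset.coe_insert, Finset.coe_singleton, Set.mem_insert_iff,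
        Set.mem_singleton_iff]
      omega
    · intro a _ b _ hab
      simp only at hab
      exact Fin.ext (by omega)
  exact this.trans Finset.card_le_two

theorem lag_comm (s t : Fin T) : lag s t = lag t s := by
  simp only [lag]; omega

/-- Bound `w_t w_s` by the mean of the two squares; every time point has at most two partners at lag
`h`. The bound is uniform in `h`, so each lag costs only `|w|²`. -/
theorem abs_lagWeight_le (w : Fin T → ℝ) (h : ℕ) : |lagWeight w h| ≤ 2 * (w ⬝ᵥ w) := by
  have key : ∑ s, ∑ t, (if lag s t = h then w s * w s else 0) ≤ 2 * (w ⬝ᵥ w) := by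
    simp only [dotProduct, Finset.mul_sum]
    refine Finset.sum_le_sum fun s _ => ?_
    rw [← Finset.sum_filter, Finset.sum_const, nsmul_eq_mul]
    have := card_lag_eq_le s h
    have h2 : ((Finset.univ.filter fun t : Fin T => lag s t = h).card : ℝ) ≤ 2 := by
      exact_mod_cast this
    exact mul_le_mul_of_nonneg_right h2 (mul_self_nonneg _)
  have key2 : ∑ s, ∑ t, (if lag s t = h then w t * w t else 0) ≤ 2 * (w ⬝ᵥ w) := by
    rw [Finset.sum_comm]
    simpa only [lag_comm] using key
  calc |lagWeight w h| ≤ ∑ s, |∑ t, if lag s t = h then w t * w s else 0| :=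
        Finset.abs_sum_le_sum_abs _ _
    _ ≤ ∑ s, ∑ t, |if lag s t = h then w t * w s else 0| :=
        Finset.sum_le_sum fun s _ => Finset.abs_sum_le_sum_abs _ _
    _ ≤ ∑ s, ∑ t, ((if lag s t = h then w s * w s else 0) / 2
          + (if lag s t = h then w t * w t else 0) / 2) := by
        refine Finset.sum_le_sum fun s _ => Finset.sum_le_sum fun t _ => ?_
        split_ifs
        · rw [abs_le]
          constructor <;> nlinarith [sq_nonneg (w s - w t), sq_nonneg (w s + w t)]
        · simp
    _ = (∑ s, ∑ t, if lag s t = h then w s * w s else 0) / 2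
          + (∑ s, ∑ t, if lag s t = h then w t * w t else 0) / 2 := by
        simp only [Finset.sum_add_distrib, Finset.sum_div]
    _ ≤ _ := by linarith

/-- Only ordered pairs `s ≤ t` occur on the right: the sample autocovariances use each pair once,
while the two-sidedness of the band is already contained in `lagWeight`. -/
theorem sum_range_lag_eq (m : ℕ) (a : ℕ → ℝ) (F : Fin T → Fin T → ℝ) :
    ∑ h ∈ Finset.range m, a h * ∑ t : Fin (T - h), F ⟨t, by omega⟩ ⟨t + h, by omega⟩
      = ∑ s : Fin T, ∑ t : Fin T, if s ≤ t ∧ (t : ℕ) < s + m then a (t - s) * F s t else 0 := by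
  simp only [sum_fin_sub_eq, Finset.mul_sum]
  rw [Finset.sum_comm]
  refine Finset.sum_congr rfl fun s _ => ?_
  rw [Finset.sum_comm]
  refine Finset.sum_congr rfl fun t _ => ?_
  split_ifs with h
  · have h1 : (s : ℕ) ≤ t := h.1
    rw [Finset.sum_eq_single_of_mem ((t : ℕ) - s) (Finset.mem_range.2 (by omega))]
    · rw [if_pos (by omega)]
    · intro b _ hb
      rw [if_neg (by omega), mul_zero]
  · refine Finset.sum_eq_zero fun b hb => ?_
    rw [if_neg, mul_zero]
    intro hb2
    have := Finset.mem_range.1 hb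
    exact h ⟨Fin.le_def.2 (by omega), by omega⟩

theorem sum_comp_injective_le {ι κ : Type*} [Fintype ι] [Fintype κ] {f : ι → κ}
    (hf : Function.Injective f) {g : κ → ℝ} (hg : ∀ k, 0 ≤ g k) : ∑ i, g (f i) ≤ ∑ k, g k := by
  classical
  rw [← Finset.sum_image (f := g) (s := Finset.univ) (g := f) (fun a _ b _ h => hf h)]
  exact Finset.sum_le_sum_of_subset_of_nonneg (Finset.subset_univ _) fun k _ _ => hg k

end Lags

/-! ### Residual autocovariances -/

section ResidualAutocovariance

open Matrix

variable {T K : ℕ}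

/-- The lagged product moment of `r`, with denominator `T - h - K`. -/
noncomputable def lagCov (K : ℕ) (r : Fin T → ℝ) (h : ℕ) : ℝ :=
  (∑ t : Fin (T - h), r ⟨t, by omega⟩ * r ⟨t + h, by omega⟩) / ((T : ℝ) - (h : ℝ) - (K : ℝ))

/-- Squared norm of the cross moment of the errors with the regressors `h` periods later. -/
noncomputable def crossLead (x : Matrix (Fin T) (Fin K) ℝ) (h : ℕ) (e : Fin T → ℝ) : ℝ :=
  ∑ k, (∑ t : Fin (T - h), x ⟨t + h, by omega⟩ k * e ⟨t, by omega⟩) ^ 2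

/-- Squared norm of the cross moment of the errors with the regressors `h` periods earlier. -/
noncomputable def crossLag (x : Matrix (Fin T) (Fin K) ℝ) (h : ℕ) (e : Fin T → ℝ) : ℝ :=
  ∑ k, (∑ t : Fin (T - h), x ⟨t, by omega⟩ k * e ⟨t + h, by omega⟩) ^ 2

/-- A bound for the effect of estimating the slopes on a lagged product moment. -/
noncomputable def slopeEffect (c : ℝ) (x : Matrix (Fin T) (Fin K) ℝ) (h : ℕ) (e : Fin T → ℝ) :
    ℝ :=
  ((1 / c ^ 2 + 1 / c) * crossLag x 0 e + (crossLead x h e + crossLag x h e) / 2) / T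

theorem crossLag_zero (x : Matrix (Fin T) (Fin K) ℝ) (e : Fin T → ℝ) :
    crossLag x 0 e = (xᵀ *ᵥ e) ⬝ᵥ (xᵀ *ᵥ e) := by
  simp only [crossLag, dotProduct, mulVec, transpose_apply, sq]
  rfl

/-- Residuals are `e - p` with `p = X δ` and `δ = (X'X)⁻¹ X'e`. The products differ by one term
quadratic in `p`, at most `|p|²`, and two cross terms `δ · u`, where `u` is a lagged cross moment of
regressors and errors. -/
theorem abs_sum_resid_sub_le {x : Matrix (Fin T) (Fin K) ℝ} {c C : ℝ} (hx : GramBounds x c C)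
    (hc : 0 < c) (hT : 0 < T) (e : Fin T → ℝ) (h : ℕ) :
    |∑ t : Fin (T - h), (olsResid x e ⟨t, by omega⟩ * olsResid x e ⟨t + h, by omega⟩
      - e ⟨t, by omega⟩ * e ⟨t + h, by omega⟩)| ≤ slopeEffect c x h e := by
  have hT' : (0 : ℝ) < T := by exact_mod_cast hT
  set q := xᵀ *ᵥ e with hq
  set δ := (xᵀ * x)⁻¹ *ᵥ q with hδ
  set p := olsWeight x q with hp
  set u₁ : Fin K → ℝ := fun k => ∑ t : Fin (T - h), x ⟨t + h, by omega⟩ k * e ⟨t, by omega⟩ with hu₁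
  set u₂ : Fin K → ℝ := fun k => ∑ t : Fin (T - h), x ⟨t, by omega⟩ k * e ⟨t + h, by omega⟩ with hu₂
  have hp_apply : ∀ t, p t = ∑ k, x t k * δ k := fun t => rfl
  have e1 : ∑ t : Fin (T - h), e ⟨t, by omega⟩ * p ⟨t + h, by omega⟩ = δ ⬝ᵥ u₁ := by
    simp only [hp_apply, dotProduct, hu₁, Finset.mul_sum]
    rw [Finset.sum_comm]
    exact Finset.sum_congr rfl fun k _ => Finset.sum_congr rfl fun t _ => by ring
  have e2 : ∑ t : Fin (T - h), p ⟨t, by omega⟩ * e ⟨t + h, by omega⟩ = δ ⬝ᵥ u₂ := by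
    simp only [hp_apply, dotProduct, hu₂, Finset.mul_sum, Finset.sum_mul]
    rw [Finset.sum_comm]
    exact Finset.sum_congr rfl fun k _ => Finset.sum_congr rfl fun t _ => by ring
  have e3 : |∑ t : Fin (T - h), p ⟨t, by omega⟩ * p ⟨t + h, by omega⟩| ≤ p ⬝ᵥ p := by
    have a1 := abs_dotProduct_le_half (fun t : Fin (T - h) => p ⟨t, by omega⟩)
      (fun t : Fin (T - h) => p ⟨t + h, by omega⟩) one_pos
    have a2 : (fun t : Fin (T - h) => p ⟨t, by omega⟩) ⬝ᵥ (fun t : Fin (T - h) => p ⟨t, by omega⟩)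
        ≤ p ⬝ᵥ p := by
      refine sum_comp_injective_le (f := fun t : Fin (T - h) => (⟨t, by omega⟩ : Fin T))
        (g := fun s => p s * p s) ?_ fun _ => mul_self_nonneg _
      intro a b hab
      simp only [Fin.mk.injEq] at hab
      exact Fin.ext hab
    have a3 : (fun t : Fin (T - h) => p ⟨t + h, by omega⟩) ⬝ᵥ
        (fun t : Fin (T - h) => p ⟨t + h, by omega⟩) ≤ p ⬝ᵥ p := by
      refine sum_comp_injective_le (f := fun t : Fin (T - h) => (⟨t + h, by omega⟩ : Fin T))
        (g := fun s => p s * p s) ?_ fun _ => mul_self_nonneg _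
      intro a b hab
      simp only [Fin.mk.injEq] at hab
      exact Fin.ext (by omega)
    refine a1.trans ?_
    linarith
  have hsplit : ∑ t : Fin (T - h), (olsResid x e ⟨t, by omega⟩ * olsResid x e ⟨t + h, by omega⟩
      - e ⟨t, by omega⟩ * e ⟨t + h, by omega⟩)
      = ∑ t : Fin (T - h), p ⟨t, by omega⟩ * p ⟨t + h, by omega⟩ - δ ⬝ᵥ u₁ - δ ⬝ᵥ u₂ := by
    rw [← e1, ← e2, ← Finset.sum_sub_distrib, ← Finset.sum_sub_distrib]
    refine Finset.sum_congr rfl fun t _ => ?_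
    simp only [olsResid, Pi.sub_apply, ← hq, ← hp]
    ring
  have hV : crossLag x 0 e = q ⬝ᵥ q := crossLag_zero x e
  -- Weight `T`: the two halves add up to `T |δ|²`, which is at most `|q|² / (c² T)` and so
  -- comparable with `|u|² / T`.
  have b1 := abs_dotProduct_le_half δ u₁ hT'
  have b2 := abs_dotProduct_le_half δ u₂ hT'
  have b3 := hx.inv_mulVec_sq_le hc hT q
  have b4 := hx.olsWeight_sq_le hc hT q
  have b5 : T * (δ ⬝ᵥ δ) ≤ (1 / c ^ 2 * (q ⬝ᵥ q)) / T := by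
    calc T * (δ ⬝ᵥ δ) ≤ T * (q ⬝ᵥ q / (c * T) ^ 2) := by gcongr
      _ = _ := by field_simp
  have b6 : q ⬝ᵥ q / (c * T) = (1 / c * (q ⬝ᵥ q)) / T := by field_simp
  have hu₁' : crossLead x h e = u₁ ⬝ᵥ u₁ := by simp only [crossLead, dotProduct, sq, hu₁]
  have hu₂' : crossLag x h e = u₂ ⬝ᵥ u₂ := by simp only [crossLag, dotProduct, sq, hu₂]
  have b7 : slopeEffect c x h e = (1 / c ^ 2 * (q ⬝ᵥ q)) / T + (1 / c * (q ⬝ᵥ q)) / T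
      + u₁ ⬝ᵥ u₁ / (2 * T) + u₂ ⬝ᵥ u₂ / (2 * T) := by
    rw [slopeEffect, hV, hu₁', hu₂']; field_simp; ring
  rw [hsplit, b7]
  have c1 := abs_le.1 b1
  have c2 := abs_le.1 b2
  have c3 := abs_le.1 e3
  rw [abs_le]
  constructor <;> linarith

/-- The error of the plug-in estimator of `w' Σ w` for a single individual with errors `e`, whose
autocovariances are `g`. -/
noncomputable def plugInError (x : Matrix (Fin T) (Fin K) ℝ) (z : Fin K → ℝ) (g : ℕ → ℝ) (m : ℕ)
    (e : Fin T → ℝ) : ℝ :=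
  ∑ s, ∑ t, ((if lag s t < m then lagCov K (olsResid x e) (lag s t) else 0) - g (lag s t)) *
    (olsWeight x z t * olsWeight x z s)

/-- The coefficient of the centered product of the errors at `s` and `t` in the leading term of
`plugInError`. -/
noncomputable def mainCoeff (x : Matrix (Fin T) (Fin K) ℝ) (z : Fin K → ℝ) (m : ℕ)
    (s t : Fin T) : ℝ :=
  if s ≤ t ∧ (t : ℕ) < s + m then
    lagWeight (olsWeight x z) (t - s) / ((T : ℝ) - ((t - s : ℕ) : ℝ) - (K : ℝ)) else 0

theorem half_le_sub_sub {m h : ℕ} (hm : 2 * (m + K) ≤ T) (hh : h < m) :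
    (T : ℝ) / 2 ≤ (T : ℝ) - (h : ℝ) - (K : ℝ) := by
  have h1 : (2 : ℝ) * (m + K) ≤ T := by exact_mod_cast hm
  have h2 : (h : ℝ) ≤ m := by exact_mod_cast hh.le
  linarith

/-- After grouping by lags, three things separate the error from its centered leading term: the
mismatch between `T - h` summands and the denominator `T - h - K`, the estimated slopes, and the
lags beyond the band. On the band the denominator is at least `T/2`. -/
theorem abs_plugInError_sub_le {x : Matrix (Fin T) (Fin K) ℝ} {c C W : ℝ} (hx : GramBounds x c C)
    (hc : 0 < c) (hT : 0 < T) (z : Fin K → ℝ) (g : ℕ → ℝ) {m : ℕ} (hm : 2 * (m + K) ≤ T)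
    (hW : olsWeight x z ⬝ᵥ olsWeight x z ≤ W) (e : Fin T → ℝ) :
    |plugInError x z g m e - ∑ s, ∑ t, mainCoeff x z m s t * (e s * e t - g (t - s))|
      ≤ 2 * W * (2 / T * ∑ h ∈ Finset.range m, (K * |g h| + slopeEffect c x h e)
          + ∑ h ∈ Finset.Ico m T, |g h|) := by
  have hT' : (0 : ℝ) < T := by exact_mod_cast hT
  set w := olsWeight x z with hw
  have hW0 : 0 ≤ W := (dotProduct_self_nonneg' w).trans hW
  have hmT : m ≤ T := by omega
  have e1 : plugInError x z g m e = ∑ h ∈ Finset.range T,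
      lagWeight w h * ((if h < m then lagCov K (olsResid x e) h else 0) - g h) :=
    sum_sum_lag_eq w fun h => (if h < m then lagCov K (olsResid x e) h else 0) - g h
  have e2 : ∑ s, ∑ t, mainCoeff x z m s t * (e s * e t - g (t - s))
      = ∑ h ∈ Finset.range m, lagWeight w h / ((T : ℝ) - (h : ℝ) - (K : ℝ)) *
        ∑ t : Fin (T - h), (e ⟨t, by omega⟩ * e ⟨t + h, by omega⟩ - g h) := by
    have := sum_range_lag_eq m (fun h => lagWeight w h / ((T : ℝ) - (h : ℝ) - (K : ℝ)))
      (fun s t : Fin T => e s * e t - g (t - s))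
    simp only [add_tsub_cancel_left] at this
    rw [this]
    refine Finset.sum_congr rfl fun s _ => Finset.sum_congr rfl fun t _ => ?_
    rw [mainCoeff]
    split_ifs
    · rfl
    · rw [zero_mul]
  have e3 : plugInError x z g m e - ∑ s, ∑ t, mainCoeff x z m s t * (e s * e t - g (t - s))
      = ∑ h ∈ Finset.range m, lagWeight w h * (lagCov K (olsResid x e) h - g h
          - (∑ t : Fin (T - h), (e ⟨t, by omega⟩ * e ⟨t + h, by omega⟩ - g h))
            / ((T : ℝ) - (h : ℝ) - (K : ℝ)))
        - ∑ h ∈ Finset.Ico m T, lagWeight w h * g h := by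
    rw [e1, e2, ← Finset.sum_range_add_sum_Ico _ hmT, add_sub_right_comm, ← Finset.sum_sub_distrib,
      sub_eq_add_neg, ← Finset.sum_neg_distrib]
    congr 1
    · refine Finset.sum_congr rfl fun h hh => ?_
      rw [if_pos (Finset.mem_range.1 hh)]
      ring
    · refine Finset.sum_congr rfl fun h hh => ?_
      rw [if_neg (not_lt.2 (Finset.mem_Ico.1 hh).1)]
      ring
  have hlw : ∀ h, |lagWeight w h| ≤ 2 * W := fun h =>
    (abs_lagWeight_le w h).trans (by linarith)
  have b1 : ∀ h ∈ Finset.range m, |lagCov K (olsResid x e) h - g h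
          - (∑ t : Fin (T - h), (e ⟨t, by omega⟩ * e ⟨t + h, by omega⟩ - g h))
            / ((T : ℝ) - (h : ℝ) - (K : ℝ))| ≤ 2 / T * (K * |g h| + slopeEffect c x h e) := by
    intro h hh
    have hh' := Finset.mem_range.1 hh
    have hL := half_le_sub_sub hm hh'
    have hL0 : 0 < (T : ℝ) - (h : ℝ) - (K : ℝ) := by linarith
    have hs := abs_sum_resid_sub_le hx hc hT e h
    have hg : ∑ _t : Fin (T - h), g h = ((T : ℝ) - h) * g h := by
      rw [Finset.sum_const, Finset.card_univ, Fintype.card_fin, nsmul_eq_mul,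
        Nat.cast_sub (by omega)]
    -- Centering removes `(T - h) g h` while the denominator accounts for `(T - h - K) g h`; the
    -- difference is the bias `K * g h`.
    have e4 : lagCov K (olsResid x e) h - g h
          - (∑ t : Fin (T - h), (e ⟨t, by omega⟩ * e ⟨t + h, by omega⟩ - g h))
            / ((T : ℝ) - (h : ℝ) - (K : ℝ))
        = (K * g h + ∑ t : Fin (T - h), (olsResid x e ⟨t, by omega⟩ *
            olsResid x e ⟨t + h, by omega⟩ - e ⟨t, by omega⟩ * e ⟨t + h, by omega⟩))
          / ((T : ℝ) - (h : ℝ) - (K : ℝ)) := by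
      rw [lagCov, Finset.sum_sub_distrib, Finset.sum_sub_distrib, hg]
      field_simp
      ring
    rw [e4, abs_div, abs_of_pos hL0, div_le_iff₀ hL0]
    have hn : |K * g h + ∑ t : Fin (T - h), (olsResid x e ⟨t, by omega⟩ *
            olsResid x e ⟨t + h, by omega⟩ - e ⟨t, by omega⟩ * e ⟨t + h, by omega⟩)|
        ≤ K * |g h| + slopeEffect c x h e := by
      refine (abs_add_le _ _).trans ?_
      rw [abs_mul, Nat.abs_cast]
      gcongr
    have hn0 : 0 ≤ K * |g h| + slopeEffect c x h e := (abs_nonneg _).trans hn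
    calc _ ≤ K * |g h| + slopeEffect c x h e := hn
      _ = 2 / T * (K * |g h| + slopeEffect c x h e) * (T / 2) := by field_simp
      _ ≤ _ := by gcongr
  rw [e3]
  refine (abs_sub _ _).trans ?_
  rw [mul_add, Finset.mul_sum]
  refine add_le_add ?_ ?_
  · refine (Finset.abs_sum_le_sum_abs _ _).trans ?_
    rw [Finset.mul_sum]
    refine Finset.sum_le_sum fun h hh => ?_
    rw [abs_mul]
    exact mul_le_mul (hlw h) (b1 h hh) (abs_nonneg _) (by positivity)
  · refine (Finset.abs_sum_le_sum_abs _ _).trans ?_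
    rw [Finset.mul_sum]
    refine Finset.sum_le_sum fun h hh => ?_
    rw [abs_mul]
    exact mul_le_mul_of_nonneg_right (hlw h) (abs_nonneg _)

theorem abs_mainCoeff_le {x : Matrix (Fin T) (Fin K) ℝ} (hT : 0 < T) {z : Fin K → ℝ} {m : ℕ}
    (hm : 2 * (m + K) ≤ T) {W : ℝ} (hW : olsWeight x z ⬝ᵥ olsWeight x z ≤ W) (s t : Fin T) :
    |mainCoeff x z m s t| ≤ if lag s t < m then 4 * W / T else 0 := by
  have hT' : (0 : ℝ) < T := by exact_mod_cast hT
  have hW0 : 0 ≤ W := (dotProduct_self_nonneg' _).trans hW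
  rw [mainCoeff]
  split_ifs with h1 h2 h2
  · have hlt : (t : ℕ) - s < m := by omega
    have hL := half_le_sub_sub hm hlt
    have hL0 : 0 < (T : ℝ) - ((t - s : ℕ) : ℝ) - (K : ℝ) := by linarith
    rw [abs_div, abs_of_pos hL0, div_le_iff₀ hL0]
    calc _ ≤ 2 * W := (abs_lagWeight_le _ _).trans (by linarith)
      _ = 4 * W / T * (T / 2) := by field_simp; ring
      _ ≤ _ := by gcongr
  · exfalso
    apply h2
    have : (s : ℕ) ≤ t := h1.1
    simp only [lag]; omega
  · simp only [abs_zero]; positivity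
  · simp

end ResidualAutocovariance

/-! ### Moments of the estimation error for fixed regressors -/

section LagSums

variable {T : ℕ}

theorem sum_lag_le {f : ℕ → ℝ} (hf : ∀ h, 0 ≤ f h) (s : Fin T) :
    ∑ t, f (lag s t) ≤ 2 * ∑ h ∈ Finset.range T, f h := by
  rw [← Finset.sum_fiberwise_of_maps_to (s := Finset.univ) (t := Finset.range T)
    (g := fun t => lag s t) (fun t _ => Finset.mem_range.2 (lag_lt s t)), Finset.mul_sum]
  refine Finset.sum_le_sum fun h _ => ?_
  rw [Finset.sum_congr rfl (g := fun _ => f h) fun t ht => by rw [(Finset.mem_filter.1 ht).2],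
    Finset.sum_const, nsmul_eq_mul]
  exact mul_le_mul_of_nonneg_right (by exact_mod_cast card_lag_eq_le s h) (hf h)

theorem sum_range_inv_sq_le (n : ℕ) : ∑ h ∈ Finset.range n, 1 / (1 + (h : ℝ)) ^ 2 ≤ 2 := by
  -- The sharper bound telescopes and therefore survives the induction.
  have key : ∀ n : ℕ, ∑ h ∈ Finset.range (n + 1), 1 / (1 + (h : ℝ)) ^ 2 ≤ 2 - 1 / ((n : ℝ) + 1) := by
    intro n
    induction n with
    | zero => norm_num
    | succ k ih =>
      rw [Finset.sum_range_succ]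
      have : 1 / (1 + ((k + 1 : ℕ) : ℝ)) ^ 2 ≤ 1 / ((k : ℝ) + 1) - 1 / (((k + 1 : ℕ) : ℝ) + 1) := by
        push_cast
        rw [div_sub_div _ _ (by positivity) (by positivity),
          div_le_div_iff₀ (by positivity) (by positivity)]
        nlinarith [(Nat.cast_nonneg k : (0 : ℝ) ≤ k)]
      linarith
  refine (Finset.sum_le_sum_of_subset_of_nonneg (Finset.range_mono (Nat.le_succ n))
    fun _ _ _ => by positivity).trans ((key n).trans ?_)
  have : (0 : ℝ) ≤ 1 / ((n : ℝ) + 1) := by positivity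
  linarith

/-- A summable weight decaying in the lag. -/
noncomputable def lagDecay (s t : Fin T) : ℝ := 1 / (1 + (lag s t : ℝ)) ^ 2

theorem lagDecay_nonneg (s t : Fin T) : 0 ≤ lagDecay s t := by
  unfold lagDecay; positivity

theorem lagDecay_comm (s t : Fin T) : lagDecay s t = lagDecay t s := by
  rw [lagDecay, lag_comm, lagDecay]

theorem sum_lagDecay_le (s : Fin T) : ∑ t, lagDecay s t ≤ 4 := by
  have := sum_lag_le (f := fun h => 1 / (1 + (h : ℝ)) ^ 2) (fun h => by positivity) s
  have h2 := sum_range_inv_sq_le T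
  simp only [lagDecay]
  linarith

/-- Indicator of a lag below the bandwidth. -/
noncomputable def inBand (m : ℕ) (s t : Fin T) : ℝ := if lag s t < m then 1 else 0

theorem inBand_nonneg (m : ℕ) (s t : Fin T) : 0 ≤ inBand m s t := by
  unfold inBand; split_ifs <;> simp

theorem inBand_comm (m : ℕ) (s t : Fin T) : inBand m s t = inBand m t s := by
  rw [inBand, lag_comm, inBand]

theorem sum_inBand_le (m : ℕ) (s : Fin T) : ∑ t, inBand m s t ≤ 2 * m := by
  have h1 := sum_lag_le (f := fun h => if h < m then (1 : ℝ) else 0)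
    (fun h => by split_ifs <;> simp) s
  have h2 : ∑ h ∈ Finset.range T, (if h < m then (1 : ℝ) else 0) ≤ m := by
    rw [← Finset.sum_filter, Finset.sum_const, nsmul_eq_mul, mul_one]
    have : ((Finset.range T).filter fun h => h < m).card ≤ (Finset.range m).card :=
      Finset.card_le_card fun h hh => Finset.mem_range.2 (Finset.mem_filter.1 hh).2
    rw [Finset.card_range] at this
    exact_mod_cast this
  simp only [inBand]
  linarith

/-- Summing `t'` over the band around `s'` costs `2m`, and `s'` is then tied to `s` by the decay. A
pair close to `s` thus costs a factor `m` and no factor `T`. -/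
theorem sum_sum_lagDecay_mul_inBand_le (m : ℕ) (s : Fin T) :
    ∑ s', ∑ t', lagDecay s s' * inBand m s' t' ≤ 8 * m := by
  calc ∑ s', ∑ t', lagDecay s s' * inBand m s' t'
      = ∑ s', lagDecay s s' * ∑ t', inBand m s' t' := by simp only [Finset.mul_sum]
    _ ≤ ∑ s', lagDecay s s' * (2 * m) := by
        gcongr with s' _
        · exact lagDecay_nonneg _ _
        · exact sum_inBand_le m s'
    _ = (∑ s', lagDecay s s') * (2 * m) := by rw [Finset.sum_mul]
    _ ≤ 4 * (2 * m) := by gcongr; exact sum_lagDecay_le s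
    _ = 8 * m := by ring

theorem sum_sum_lagDecay_mul_inBand_le' (m : ℕ) (s : Fin T) :
    ∑ s', ∑ t', lagDecay s t' * inBand m s' t' ≤ 8 * m := by
  rw [Finset.sum_comm]
  simpa only [inBand_comm] using sum_sum_lagDecay_mul_inBand_le m s

/-- Sum of the lag decays between the members of two pairs of time points. -/
noncomputable def pairDecay (s t s' t' : Fin T) : ℝ :=
  lagDecay s s' + lagDecay s t' + lagDecay t s' + lagDecay t t'

theorem sum_sum_pairDecay_mul_inBand_le (m : ℕ) (s t : Fin T) :
    ∑ s', ∑ t', pairDecay s t s' t' * inBand m s' t' ≤ 32 * m := by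
  have h1 := sum_sum_lagDecay_mul_inBand_le m s
  have h2 := sum_sum_lagDecay_mul_inBand_le' m s
  have h3 := sum_sum_lagDecay_mul_inBand_le m t
  have h4 := sum_sum_lagDecay_mul_inBand_le' m t
  simp only [pairDecay, add_mul, Finset.sum_add_distrib]
  linarith

end LagSums

/-! ### Second moments of weighted error sums and the resulting tail bound. -/

section Moments

open Matrix

variable {Ω : Type*} [MeasurableSpace Ω] {P : Measure Ω}

theorem integrable_sum_mul_sq {ι : Type*} [Fintype ι] {Y : ι → Ω → ℝ} (a : ι → ℝ)
    (hY : ∀ p q, Integrable (fun ω => Y p ω * Y q ω) P) :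
    Integrable (fun ω => (∑ p, a p * Y p ω) ^ 2) P := by
  have : (fun ω => (∑ p, a p * Y p ω) ^ 2)
      = fun ω => ∑ p, ∑ q, (a p * a q) * (Y p ω * Y q ω) := by
    funext ω
    rw [sq, Finset.sum_mul_sum]
    exact Finset.sum_congr rfl fun p _ => Finset.sum_congr rfl fun q _ => by ring
  rw [this]
  exact integrable_finsetSum _ fun p _ => integrable_finsetSum _ fun q _ => (hY p q).const_mul _

theorem integral_sum_mul_sq_le {ι : Type*} [Fintype ι] {Y : ι → Ω → ℝ} (a : ι → ℝ)
    (hY : ∀ p q, Integrable (fun ω => Y p ω * Y q ω) P) :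
    ∫ ω, (∑ p, a p * Y p ω) ^ 2 ∂P ≤ ∑ p, ∑ q, |a p| * |a q| * |∫ ω, Y p ω * Y q ω ∂P| := by
  have : (fun ω => (∑ p, a p * Y p ω) ^ 2)
      = fun ω => ∑ p, ∑ q, (a p * a q) * (Y p ω * Y q ω) := by
    funext ω
    rw [sq, Finset.sum_mul_sum]
    exact Finset.sum_congr rfl fun p _ => Finset.sum_congr rfl fun q _ => by ring
  rw [this, integral_finsetSum _ fun p _ => integrable_finsetSum _ fun q _ =>
    (hY p q).const_mul _]
  refine Finset.sum_le_sum fun p _ => ?_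
  rw [integral_finsetSum _ fun q _ => (hY p q).const_mul _]
  refine Finset.sum_le_sum fun q _ => ?_
  rw [integral_const_mul, ← abs_mul, ← abs_mul]
  exact le_abs_self _

/-- Schur's test: the decay kernel is symmetric with row sums at most `4`. -/
theorem integral_sum_mul_sq_le_of_lagDecay {L : ℕ} {u : Fin L → Ω → ℝ} (a : Fin L → ℝ) {C₁ : ℝ}
    (hC₁ : 0 ≤ C₁) (hu : ∀ p q, Integrable (fun ω => u p ω * u q ω) P)
    (hd : ∀ p q, |∫ ω, u p ω * u q ω ∂P| ≤ C₁ * lagDecay p q) :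
    ∫ ω, (∑ p, a p * u p ω) ^ 2 ∂P ≤ 4 * C₁ * ∑ p, a p ^ 2 := by
  refine (integral_sum_mul_sq_le a hu).trans ?_
  have key : ∑ p, ∑ q, a p ^ 2 * lagDecay p q ≤ 4 * ∑ p, a p ^ 2 := by
    rw [Finset.mul_sum]
    refine Finset.sum_le_sum fun p _ => ?_
    rw [← Finset.mul_sum]
    nlinarith [sum_lagDecay_le p, sq_nonneg (a p)]
  have key2 : ∑ p, ∑ q, a q ^ 2 * lagDecay p q ≤ 4 * ∑ p, a p ^ 2 := by
    rw [Finset.sum_comm]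
    simpa only [lagDecay_comm] using key
  calc ∑ p, ∑ q, |a p| * |a q| * |∫ ω, u p ω * u q ω ∂P|
      ≤ ∑ p, ∑ q, (C₁ / 2 * (a p ^ 2 * lagDecay p q) + C₁ / 2 * (a q ^ 2 * lagDecay p q)) := by
        refine Finset.sum_le_sum fun p _ => Finset.sum_le_sum fun q _ => ?_
        have h1 : |a p| * |a q| ≤ (a p ^ 2 + a q ^ 2) / 2 := by
          rw [← sq_abs (a p), ← sq_abs (a q)]
          nlinarith [sq_nonneg (|a p| - |a q|)]
        calc _ ≤ (a p ^ 2 + a q ^ 2) / 2 * (C₁ * lagDecay p q) :=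
              mul_le_mul h1 (hd p q) (abs_nonneg _) (by positivity)
          _ = _ := by ring
    _ = C₁ / 2 * ∑ p, ∑ q, a p ^ 2 * lagDecay p q + C₁ / 2 * ∑ p, ∑ q, a q ^ 2 * lagDecay p q := by
        simp only [Finset.sum_add_distrib, Finset.mul_sum]
    _ ≤ C₁ / 2 * (4 * ∑ p, a p ^ 2) + C₁ / 2 * (4 * ∑ p, a p ^ 2) := by gcongr
    _ = _ := by ring

variable {N T K : ℕ}

/-- Moment conditions on a panel of errors whose `i`-th row has autocovariances `g i`. -/
structure PanelMoments (P : Measure Ω) (e : Ω → Fin N → Fin T → ℝ) (g : Fin N → ℕ → ℝ)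
    (C₁ C₂ : ℝ) : Prop where
  measurable : ∀ i t, Measurable fun ω => e ω i t
  memLp_mul : ∀ i s t, MemLp (fun ω => e ω i s * e ω i t) 2 P
  integral_mul : ∀ i s t, ∫ ω, e ω i s * e ω i t ∂P = g i (lag s t)
  abs_le : ∀ i h, h < T → |g i h| ≤ C₁ / (1 + (h : ℝ)) ^ 2
  abs_cov_le : ∀ i j s t s' t',
    |∫ ω, (e ω i s * e ω i t - g i (lag s t)) * (e ω j s' * e ω j t' - g j (lag s' t')) ∂P|
      ≤ C₂ * (lagDecay i j * pairDecay s t s' t')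

namespace PanelMoments

variable {e : Ω → Fin N → Fin T → ℝ} {g : Fin N → ℕ → ℝ} {C₁ C₂ : ℝ}

theorem abs_integral_mul_le (hP : PanelMoments P e g C₁ C₂) (i : Fin N) (s t : Fin T) :
    |∫ ω, e ω i s * e ω i t ∂P| ≤ C₁ * lagDecay s t := by
  rw [hP.integral_mul, lagDecay, mul_one_div]
  exact hP.abs_le i _ (lag_lt s t)

variable [IsProbabilityMeasure P]

theorem integrable_mul (hP : PanelMoments P e g C₁ C₂) (i : Fin N) (s t : Fin T) :
    Integrable (fun ω => e ω i s * e ω i t) P :=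
  (hP.memLp_mul i s t).integrable (by norm_num)

/-- For each regressor, Schur's test leaves the sum of its squares over time. Summed over regressors
this is at most the trace of the Gram matrix, of order `T`. -/
theorem crossLead_bound (hP : PanelMoments P e g C₁ C₂) (hC₁ : 0 ≤ C₁)
    {x : Matrix (Fin T) (Fin K) ℝ} {c C : ℝ} (hx : GramBounds x c C) (i : Fin N) (h : ℕ) :
    Integrable (fun ω => crossLead x h (e ω i)) P ∧
      ∫ ω, crossLead x h (e ω i) ∂P ≤ 4 * C₁ * (C * T) := by
  have hint : ∀ k, Integrable (fun ω => (∑ t : Fin (T - h), x ⟨t + h, by omega⟩ k *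
      e ω i ⟨t, by omega⟩) ^ 2) P := fun k =>
    integrable_sum_mul_sq _ fun p q => hP.integrable_mul i ⟨p, by omega⟩ ⟨q, by omega⟩
  refine ⟨integrable_finsetSum _ fun k _ => hint k, ?_⟩
  simp only [crossLead]
  rw [integral_finsetSum _ fun k _ => hint k]
  refine le_trans ?_ (mul_le_mul_of_nonneg_left hx.upper (by positivity))
  rw [Finset.mul_sum]
  refine Finset.sum_le_sum fun k _ => ?_
  refine (integral_sum_mul_sq_le_of_lagDecay (u := fun (t : Fin (T - h)) ω => e ω i ⟨t, by omega⟩)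
    _ hC₁ (fun p q => hP.integrable_mul i _ _) fun p q => ?_).trans ?_
  · exact hP.abs_integral_mul_le i ⟨p, by omega⟩ ⟨q, by omega⟩
  · refine mul_le_mul_of_nonneg_left ?_ (by positivity)
    refine sum_comp_injective_le (f := fun t : Fin (T - h) => (⟨t + h, by omega⟩ : Fin T))
      (g := fun t => x t k ^ 2) ?_ fun _ => sq_nonneg _
    intro a b hab
    simp only [Fin.mk.injEq] at hab
    exact Fin.ext (by omega)

theorem crossLag_bound (hP : PanelMoments P e g C₁ C₂) (hC₁ : 0 ≤ C₁)
    {x : Matrix (Fin T) (Fin K) ℝ} {c C : ℝ} (hx : GramBounds x c C) (i : Fin N) (h : ℕ) :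
    Integrable (fun ω => crossLag x h (e ω i)) P ∧
      ∫ ω, crossLag x h (e ω i) ∂P ≤ 4 * C₁ * (C * T) := by
  have hint : ∀ k, Integrable (fun ω => (∑ t : Fin (T - h), x ⟨t, by omega⟩ k *
      e ω i ⟨t + h, by omega⟩) ^ 2) P := fun k =>
    integrable_sum_mul_sq _ fun p q => hP.integrable_mul i ⟨p + h, by omega⟩ ⟨q + h, by omega⟩
  refine ⟨integrable_finsetSum _ fun k _ => hint k, ?_⟩
  simp only [crossLag]
  rw [integral_finsetSum _ fun k _ => hint k]
  refine le_trans ?_ (mul_le_mul_of_nonneg_left hx.upper (by positivity))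
  rw [Finset.mul_sum]
  refine Finset.sum_le_sum fun k _ => ?_
  refine (integral_sum_mul_sq_le_of_lagDecay
    (u := fun (t : Fin (T - h)) ω => e ω i ⟨t + h, by omega⟩)
    _ hC₁ (fun p q => hP.integrable_mul i _ _) fun p q => ?_).trans ?_
  -- Shifting both times by `h` leaves their lag unchanged.
  · have := hP.abs_integral_mul_le i ⟨p + h, by omega⟩ ⟨q + h, by omega⟩
    simpa [lagDecay, lag] using this
  · refine mul_le_mul_of_nonneg_left ?_ (by positivity)
    refine sum_comp_injective_le (f := fun t : Fin (T - h) => (⟨t, by omega⟩ : Fin T))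
      (g := fun t => x t k ^ 2) ?_ fun _ => sq_nonneg _
    intro a b hab
    simp only [Fin.mk.injEq] at hab
    exact Fin.ext hab

/-- All squared cross moments have mean of order `T`, and `slopeEffect` divides by `T`. Hence
estimating the slopes costs a constant in mean, uniformly in the lag. -/
theorem slopeEffect_bound (hP : PanelMoments P e g C₁ C₂) (hC₁ : 0 ≤ C₁)
    {x : Matrix (Fin T) (Fin K) ℝ} {c C : ℝ} (hc : 0 < c) (hT : 0 < T) (hx : GramBounds x c C)
    (i : Fin N) (h : ℕ) :
    Integrable (fun ω => slopeEffect c x h (e ω i)) P ∧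
      ∫ ω, slopeEffect c x h (e ω i) ∂P ≤ 4 * C₁ * C * (1 / c ^ 2 + 1 / c + 1) := by
  have hT' : (0 : ℝ) < T := by exact_mod_cast hT
  obtain ⟨i0, b0⟩ := hP.crossLag_bound hC₁ hx i 0
  obtain ⟨i1, b1⟩ := hP.crossLead_bound hC₁ hx i h
  obtain ⟨i2, b2⟩ := hP.crossLag_bound hC₁ hx i h
  have i12 : Integrable (fun ω => crossLead x h (e ω i) + crossLag x h (e ω i)) P := i1.add i2
  have i3 := (i0.const_mul (1 / c ^ 2 + 1 / c)).add (i12.div_const 2)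
  refine ⟨i3.div_const T, ?_⟩
  simp only [slopeEffect]
  have hc2 : 0 ≤ 1 / c ^ 2 + 1 / c := by positivity
  rw [integral_div, div_le_iff₀ hT', integral_add (i0.const_mul _) (i12.div_const 2),
    integral_const_mul, integral_div]
  have : ∫ ω, (crossLead x h (e ω i) + crossLag x h (e ω i)) ∂P ≤ 2 * (4 * C₁ * (C * T)) := by
    rw [integral_add i1 i2]; linarith
  have h3 := mul_le_mul_of_nonneg_left b0 hc2
  linarith

/-- The leading term of the estimation error. -/
theorem main_bound (hP : PanelMoments P e g C₁ C₂) (hN : 0 < N) (hC₂ : 0 ≤ C₂) {κ : ℝ}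
    {m : ℕ} {a : Fin N → Fin T → Fin T → ℝ}
    (ha : ∀ i s t, |a i s t| ≤ κ * inBand m s t) (hκ : 0 ≤ κ) :
    Integrable (fun ω => ((1 / (N : ℝ)) * ∑ i, ∑ s, ∑ t, a i s t *
      (e ω i s * e ω i t - g i (lag s t))) ^ 2) P ∧
    ∫ ω, ((1 / (N : ℝ)) * ∑ i, ∑ s, ∑ t, a i s t * (e ω i s * e ω i t - g i (lag s t))) ^ 2 ∂P
      ≤ 256 * C₂ * κ ^ 2 * m ^ 2 * T / N := by
  have hN' : (0 : ℝ) < N := by exact_mod_cast hN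
  set Y : Fin N × Fin T × Fin T → Ω → ℝ :=
    fun p ω => e ω p.1 p.2.1 * e ω p.1 p.2.2 - g p.1 (lag p.2.1 p.2.2) with hY
  set b : Fin N × Fin T × Fin T → ℝ := fun p => a p.1 p.2.1 p.2.2 with hb
  have hYL : ∀ p, MemLp (Y p) 2 P := fun p => (hP.memLp_mul _ _ _).sub (memLp_const _)
  have hYY : ∀ p q, Integrable (fun ω => Y p ω * Y q ω) P := fun p q =>
    (hYL p).integrable_mul (hYL q)
  have hsum : ∀ ω, ∑ i, ∑ s, ∑ t, a i s t * (e ω i s * e ω i t - g i (lag s t))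
      = ∑ p, b p * Y p ω := by
    intro ω
    rw [Fintype.sum_prod_type]
    refine Finset.sum_congr rfl fun i _ => ?_
    rw [Fintype.sum_prod_type]
  simp_rw [hsum, mul_pow]
  refine ⟨(integrable_sum_mul_sq b hYY).const_mul _, ?_⟩
  rw [integral_const_mul]
  have h1 := integral_sum_mul_sq_le b hYY
  have h2 : ∑ p, ∑ q, |b p| * |b q| * |∫ ω, Y p ω * Y q ω ∂P|
      ≤ 256 * C₂ * κ ^ 2 * m ^ 2 * T * N := by
    -- With one product fixed, the decay in `j` sums to `4` and the decay between the time pairs to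
    -- `32 m`, hence `128 m`.
    have hstep : ∀ p : Fin N × Fin T × Fin T, ∑ q, |b p| * |b q| * |∫ ω, Y p ω * Y q ω ∂P|
        ≤ κ ^ 2 * C₂ * (128 * m) * inBand m p.2.1 p.2.2 := by
      rintro ⟨i, s, t⟩
      have h3 : ∀ q : Fin N × Fin T × Fin T,
          |b (i, s, t)| * |b q| * |∫ ω, Y (i, s, t) ω * Y q ω ∂P|
          ≤ (κ ^ 2 * C₂ * inBand m s t) *
            (lagDecay i q.1 * (pairDecay s t q.2.1 q.2.2 * inBand m q.2.1 q.2.2)) := by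
        rintro ⟨j, s', t'⟩
        have a1 := ha i s t
        have a2 := ha j s' t'
        have a3 := hP.abs_cov_le i j s t s' t'
        have n1 := inBand_nonneg m s t
        have n2 := inBand_nonneg m s' t'
        calc _ ≤ (κ * inBand m s t) * (κ * inBand m s' t') *
              (C₂ * (lagDecay i j * pairDecay s t s' t')) := by
              refine mul_le_mul (mul_le_mul a1 a2 (abs_nonneg _) (by positivity)) a3
                (abs_nonneg _) (by positivity)
          _ = _ := by ring
      refine (Finset.sum_le_sum fun q _ => h3 q).trans ?_
      rw [← Finset.mul_sum]
      have h4 : ∑ q : Fin N × Fin T × Fin T,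
          lagDecay i q.1 * (pairDecay s t q.2.1 q.2.2 * inBand m q.2.1 q.2.2) ≤ 128 * m := by
        calc _ = ∑ j, lagDecay i j * ∑ s', ∑ t', pairDecay s t s' t' * inBand m s' t' := by
              rw [Fintype.sum_prod_type]
              refine Finset.sum_congr rfl fun j _ => ?_
              rw [Fintype.sum_prod_type, Finset.mul_sum]
              refine Finset.sum_congr rfl fun s' _ => ?_
              rw [Finset.mul_sum]
          _ ≤ ∑ j, lagDecay i j * (32 * m) := by
              gcongr with j _
              · exact lagDecay_nonneg _ _
              · exact sum_sum_pairDecay_mul_inBand_le m s t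
          _ = (∑ j, lagDecay i j) * (32 * m) := by rw [Finset.sum_mul]
          _ ≤ 4 * (32 * m) := by gcongr; exact sum_lagDecay_le i
          _ = _ := by ring
      have n1 := inBand_nonneg m s t
      calc _ ≤ (κ ^ 2 * C₂ * inBand m s t) * (128 * m) := by gcongr
        _ = _ := by ring
    refine (Finset.sum_le_sum fun p _ => hstep p).trans ?_
    rw [← Finset.mul_sum]
    -- `N T` choices of `(i, s)` with at most `2 m` partners `t` each; `256 = 128 · 2`.
    have h5 : ∑ p : Fin N × Fin T × Fin T, inBand m p.2.1 p.2.2 ≤ N * (T * (2 * m)) := by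
      rw [Fintype.sum_prod_type]
      calc _ ≤ ∑ _i : Fin N, ((T : ℝ) * (2 * m)) := by
            refine Finset.sum_le_sum fun i _ => ?_
            rw [Fintype.sum_prod_type]
            calc _ ≤ ∑ _s : Fin T, (2 * (m : ℝ)) := Finset.sum_le_sum fun s _ => sum_inBand_le m s
              _ = _ := by simp
        _ = _ := by simp
    calc _ ≤ κ ^ 2 * C₂ * (128 * m) * (N * (T * (2 * m))) := by gcongr
      _ = _ := by ring
  have h6 := h1.trans h2
  calc (1 / (N : ℝ)) ^ 2 * ∫ ω, (∑ p, b p * Y p ω) ^ 2 ∂P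
      ≤ (1 / (N : ℝ)) ^ 2 * (256 * C₂ * κ ^ 2 * m ^ 2 * T * N) := by gcongr
    _ = _ := by field_simp

/-- Tail bound for the estimation error with fixed regressors. -/
theorem measure_plugInError_le (hP : PanelMoments P e g C₁ C₂) (hC₁ : 0 ≤ C₁) (hC₂ : 0 ≤ C₂)
    (hN : 0 < N) (hT : 0 < T) {m : ℕ} (hm : 1 ≤ m) (hmT : 2 * (m + K) ≤ T)
    {x : Fin N → Matrix (Fin T) (Fin K) ℝ} {c C Z τ l : ℝ} (hc : 0 < c) (hC : 0 ≤ C)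
    (hx : ∀ i, GramBounds (x i) c C) {z : Fin N → Fin K → ℝ} (hz : ∀ i, z i ⬝ᵥ z i ≤ Z)
    (hZ : 0 ≤ Z) (hτ : ∀ i, ∑ h ∈ Finset.Ico m T, |g i h| ≤ τ) (hl : 0 < l) :
    P.real {ω | l < |(1 / (N : ℝ)) * ∑ i, plugInError (x i) (z i) (g i) m (e ω i)|}
      ≤ (2048 * C₂ * (Z / c) ^ 2 + 1 + 4 * (Z / c) * (K * C₁ + 4 * C₁ * C * (1 / c ^ 2 + 1 / c + 1))
          + 2 * (Z / c)) *
        (m / (T : ℝ) ^ 2 + m / (√(N : ℝ) * (T : ℝ) ^ (3 / 2 : ℝ)) + τ / T) / l := by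
  have hN' : (0 : ℝ) < N := by exact_mod_cast hN
  have hT' : (0 : ℝ) < T := by exact_mod_cast hT
  have hm' : (0 : ℝ) < m := by exact_mod_cast hm
  set W : ℝ := Z / (c * T) with hWdef
  have hW0 : 0 ≤ W := by positivity
  have hW : ∀ i, olsWeight (x i) (z i) ⬝ᵥ olsWeight (x i) (z i) ≤ W := fun i =>
    ((hx i).olsWeight_sq_le hc hT (z i)).trans (by rw [hWdef]; gcongr; exact hz i)
  have hτ0 : 0 ≤ τ := (Finset.sum_nonneg fun _ _ => abs_nonneg _).trans (hτ ⟨0, hN⟩)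
  set S : Ω → ℝ := fun ω => (1 / (N : ℝ)) * ∑ i, ∑ s, ∑ t, mainCoeff (x i) (z i) m s t *
    (e ω i s * e ω i t - g i (lag s t)) with hS
  obtain ⟨hSi, hSb⟩ := hP.main_bound hN hC₂ (a := fun i => mainCoeff (x i) (z i) m)
    (κ := 4 * W / T) (m := m) (fun i s t => by
      have := abs_mainCoeff_le hT hmT (hW i) s t
      rw [inBand, mul_ite, mul_one, mul_zero]
      exact this) (by positivity)
  change Integrable (fun ω => S ω ^ 2) P at hSi
  set B : Fin N → Ω → ℝ := fun i ω => 2 * W * (2 / T * ∑ h ∈ Finset.range m,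
    (K * |g i h| + slopeEffect c (x i) h (e ω i)) + ∑ h ∈ Finset.Ico m T, |g i h|) with hB
  set S₀ : ℝ := 4 * C₁ * C * (1 / c ^ 2 + 1 / c + 1) with hS₀
  have hterm : ∀ i h, Integrable (fun ω => K * |g i h| + slopeEffect c (x i) h (e ω i)) P :=
    fun i h => (integrable_const _).add (hP.slopeEffect_bound hC₁ hc hT (hx i) i h).1
  have hsumi : ∀ i, Integrable (fun ω => ∑ h ∈ Finset.range m,
      (K * |g i h| + slopeEffect c (x i) h (e ω i))) P := fun i =>
    integrable_finsetSum _ fun h _ => hterm i h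
  have hBi : ∀ i, Integrable (B i) P := fun i =>
    (((hsumi i).const_mul _).add (integrable_const _)).const_mul _
  have hBb : ∀ i, ∫ ω, B i ω ∂P ≤ 2 * W * (2 / T * (m * (K * C₁ + S₀)) + τ) := by
    intro i
    simp only [hB]
    rw [integral_const_mul, integral_add ((hsumi i).const_mul _) (integrable_const _),
      integral_const_mul, integral_finsetSum _ fun h _ => hterm i h]
    have hs : ∑ h ∈ Finset.range m, ∫ ω, (K * |g i h| + slopeEffect c (x i) h (e ω i)) ∂P
        ≤ m * (K * C₁ + S₀) := by
      calc _ ≤ ∑ _h ∈ Finset.range m, (K * C₁ + S₀) := by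
            refine Finset.sum_le_sum fun h hh => ?_
            obtain ⟨j1, j2⟩ := hP.slopeEffect_bound hC₁ hc hT (hx i) i h
            rw [integral_add (integrable_const _) j1]
            have hg : |g i h| ≤ C₁ := by
              refine (hP.abs_le i h (by have := Finset.mem_range.1 hh; omega)).trans ?_
              refine div_le_self hC₁ (one_le_pow₀ ?_)
              have : (0 : ℝ) ≤ h := Nat.cast_nonneg h
              linarith
            have := mul_le_mul_of_nonneg_left hg (Nat.cast_nonneg K : (0 : ℝ) ≤ K)
            simp only [integral_const, probReal_univ, one_smul]
            linarith
        _ = _ := by simp only [Finset.sum_const, Finset.card_range, nsmul_eq_mul]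
    have ht := hτ i
    simp only [integral_const, probReal_univ, one_smul]
    gcongr 2 * W * (2 / T * ?_ + ?_)
  -- `σ` is the order of the root mean square of `S`.
  set σ : ℝ := m / (√(N : ℝ) * (T : ℝ) ^ (3 / 2 : ℝ)) with hσ
  have hσ0 : 0 < σ := by positivity
  have hσ2 : σ ^ 2 = m ^ 2 / (N * T ^ 3) := by
    rw [hσ, div_pow, mul_pow, Real.sq_sqrt hN'.le, ← Real.rpow_natCast ((T : ℝ) ^ (3 / 2 : ℝ)) 2,
      ← Real.rpow_mul hT'.le]
    norm_num
  -- A single integrable majorant: `|S| ≤ (S²/σ + σ)/2` turns the second moment into a first-moment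
  -- bound of order `σ`, so one application of Markov's inequality covers all terms.
  set R : Ω → ℝ := fun ω => (S ω ^ 2 / σ + σ) / 2 + (1 / (N : ℝ)) * ∑ i, B i ω with hR
  have hSσ : Integrable (fun ω => S ω ^ 2 / σ + σ) P := (hSi.div_const σ).add (integrable_const _)
  have hBs : Integrable (fun ω => ∑ i, B i ω) P := integrable_finsetSum _ fun i _ => hBi i
  have hRi : Integrable R P := (hSσ.div_const 2).add (hBs.const_mul _)
  have hle : ∀ ω, |(1 / (N : ℝ)) * ∑ i, plugInError (x i) (z i) (g i) m (e ω i)| ≤ R ω := by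
    intro ω
    have e1 : (1 / (N : ℝ)) * ∑ i, plugInError (x i) (z i) (g i) m (e ω i)
        = S ω + (1 / (N : ℝ)) * ∑ i, (plugInError (x i) (z i) (g i) m (e ω i)
          - ∑ s, ∑ t, mainCoeff (x i) (z i) m s t * (e ω i s * e ω i t - g i (t - s))) := by
      simp only [hS]
      rw [← mul_add, ← Finset.sum_add_distrib]
      congr 1
      refine Finset.sum_congr rfl fun i _ => ?_
      rw [eq_comm, ← sub_eq_zero]
      have : ∑ s, ∑ t, mainCoeff (x i) (z i) m s t * (e ω i s * e ω i t - g i (lag s t))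
          = ∑ s, ∑ t, mainCoeff (x i) (z i) m s t * (e ω i s * e ω i t - g i (t - s)) := by
        refine Finset.sum_congr rfl fun s _ => Finset.sum_congr rfl fun t _ => ?_
        rw [mainCoeff]
        split_ifs with h
        · have h1 : (s : ℕ) ≤ t := h.1
          have h2 : lag s t = (t : ℕ) - s := by simp only [lag]; omega
          rw [h2]
        · simp
      rw [this]
      ring
    rw [e1]
    refine (abs_add_le _ _).trans (add_le_add ?_ ?_)
    · have h2 : (S ω ^ 2 / σ + σ) / 2 - |S ω| = (|S ω| - σ) ^ 2 / (2 * σ) := by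
        rw [← sq_abs (S ω)]; field_simp; ring
      have : 0 ≤ (|S ω| - σ) ^ 2 / (2 * σ) := by positivity
      linarith
    · rw [abs_mul, abs_of_nonneg (by positivity : (0 : ℝ) ≤ 1 / N)]
      refine mul_le_mul_of_nonneg_left ?_ (by positivity)
      refine (Finset.abs_sum_le_sum_abs _ _).trans (Finset.sum_le_sum fun i _ => ?_)
      exact abs_plugInError_sub_le (hx i) hc hT (z i) (g i) hmT (hW i) (e ω i)
  have hRb : ∫ ω, R ω ∂P ≤ (2048 * C₂ * (Z / c) ^ 2 + 1 + 4 * (Z / c) * (K * C₁ + S₀)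
      + 2 * (Z / c)) * (m / (T : ℝ) ^ 2 + σ + τ / T) := by
    simp only [hR]
    rw [integral_add (hSσ.div_const 2) (hBs.const_mul _), integral_div,
      integral_add (hSi.div_const σ) (integrable_const _), integral_div, integral_const_mul,
      integral_finsetSum _ fun i _ => hBi i]
    -- `4096 = 256 · 4²`, from the coefficient bound `4 W / T` with `W = Z / (c T)`. The factor
    -- `1/2` in `R` turns it into `2048`.
    have h1 : (∫ ω, S ω ^ 2 ∂P) / σ ≤ 4096 * C₂ * (Z / c) ^ 2 * σ := by
      rw [div_le_iff₀ hσ0]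
      refine hSb.trans (le_of_eq ?_)
      rw [mul_assoc _ σ σ, ← sq, hσ2, hWdef]
      field_simp
      ring
    have h2 : (1 / (N : ℝ)) * ∑ i, ∫ ω, B i ω ∂P
        ≤ 2 * W * (2 / T * (m * (K * C₁ + S₀)) + τ) := by
      have : ∑ i, ∫ ω, B i ω ∂P ≤ ∑ _i : Fin N, 2 * W * (2 / T * (m * (K * C₁ + S₀)) + τ) :=
        Finset.sum_le_sum fun i _ => hBb i
      rw [Finset.sum_const, Finset.card_univ, Fintype.card_fin, nsmul_eq_mul] at this
      calc _ ≤ (1 / (N : ℝ)) * (N * (2 * W * (2 / T * (m * (K * C₁ + S₀)) + τ))) := by gcongr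
        _ = _ := by field_simp
    have h3 : 2 * W * (2 / T * (m * (K * C₁ + S₀)) + τ)
        = 4 * (Z / c) * (K * C₁ + S₀) * (m / (T : ℝ) ^ 2) + 2 * (Z / c) * (τ / T) := by
      rw [hWdef]; field_simp
      ring
    simp only [integral_const, probReal_univ, one_smul]
    have p1 : 0 ≤ m / (T : ℝ) ^ 2 := by positivity
    have p2 : 0 ≤ τ / T := by positivity
    have p3 : 0 ≤ 2048 * C₂ * (Z / c) ^ 2 + 1 := by positivity
    have p4 : 0 ≤ 4 * (Z / c) * (K * C₁ + S₀) := by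
      have : 0 ≤ S₀ := by positivity
      positivity
    have p5 : 0 ≤ 2 * (Z / c) := by positivity
    nlinarith [mul_nonneg p3 p1, mul_nonneg p3 p2, mul_nonneg p4 hσ0.le, mul_nonneg p4 p2,
      mul_nonneg p5 p1, mul_nonneg p5 hσ0.le]
  have hR0 : ∀ ω, 0 ≤ R ω := fun ω => (abs_nonneg _).trans (hle ω)
  have hmk := mul_meas_ge_le_integral_of_nonneg (Eventually.of_forall hR0) hRi l
  rw [le_div_iff₀ hl, mul_comm]
  refine le_trans ?_ (hmk.trans hRb)
  refine mul_le_mul_of_nonneg_left (measureReal_mono fun ω hω => ?_) hl.le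
  exact le_of_lt (lt_of_lt_of_le hω (hle ω))

end PanelMoments

end Moments

/-! ### Covariances of mixing panels -/

section PanelMixing

variable {Ω : Type*} [m0 : MeasurableSpace Ω] {P : Measure Ω} {N T : ℕ}
  {e : Ω → Fin N → Fin T → ℝ}

theorem panelSigma_le (he : ∀ i t, Measurable fun ω => e ω i t) (I : Set (Fin N × Fin T)) :
    panelSigma e I ≤ m0 :=
  iSup₂_le fun z _ => (he z.1 z.2).comap_le

theorem measurable_panelSigma {Ω : Type*} {e : Ω → Fin N → Fin T → ℝ} {I : Set (Fin N × Fin T)} {i : Fin N} {t : Fin T}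
    (h : (i, t) ∈ I) : Measurable[panelSigma e I] fun ω => e ω i t :=
  (comap_measurable fun ω => e ω i t).mono
    (le_iSup₂_of_le (f := fun (z : Fin N × Fin T) (_ : z ∈ I) =>
      MeasurableSpace.comap (fun ω => e ω z.1 z.2) inferInstance) (i, t) h le_rfl) le_rfl

theorem panelDist_eq (p q : Fin N × Fin T) : panelDist p q = max (lag p.1 q.1) (lag p.2 q.2) := rfl

variable [IsProbabilityMeasure P]

theorem abs_measureReal_inter_sub_le_one (A B : Set Ω) :
    |P.real (A ∩ B) - P.real A * P.real B| ≤ 1 := by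
  have h1 : P.real (A ∩ B) ≤ 1 := measureReal_le_one
  have h2 : P.real A ≤ 1 := measureReal_le_one
  have h3 : P.real B ≤ 1 := measureReal_le_one
  have h4 : 0 ≤ P.real (A ∩ B) := measureReal_nonneg
  have h5 : 0 ≤ P.real A := measureReal_nonneg
  have h6 : 0 ≤ P.real B := measureReal_nonneg
  rw [abs_le]
  constructor <;> nlinarith [mul_nonneg h5 h6]

theorem alphaMixing_le_one (r : ℕ) : alphaMixing P e r ≤ 1 := by
  refine csSup_le ⟨_, ∅, ∅, by simp, ∅, ∅, @MeasurableSet.empty _ (panelSigma e ∅),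
    @MeasurableSet.empty _ (panelSigma e ∅), rfl⟩ ?_
  rintro c ⟨I, J, _, A, B, _, _, rfl⟩
  exact abs_measureReal_inter_sub_le_one A B

/-- The set defining `alphaMixing` is bounded by one. Without a bound the real `sSup` would take its
default value and dominate nothing. -/
theorem abs_measureReal_inter_sub_le_alphaMixing {I J : Set (Fin N × Fin T)} {r : ℕ}
    (hIJ : ∀ p ∈ I, ∀ q ∈ J, r ≤ panelDist p q) (A B : Set Ω) (hA : MeasurableSet[panelSigma e I] A)
    (hB : MeasurableSet[panelSigma e J] B) :
    |P.real (A ∩ B) - P.real A * P.real B| ≤ alphaMixing P e r := by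
  refine le_csSup ⟨1, ?_⟩ ⟨I, J, hIJ, A, B, hA, hB, rfl⟩
  rintro c ⟨I, J, _, A, B, _, _, rfl⟩
  exact abs_measureReal_inter_sub_le_one A B

theorem alphaMixing_nonneg (r : ℕ) : 0 ≤ alphaMixing P e r :=
  (abs_nonneg _).trans (abs_measureReal_inter_sub_le_alphaMixing (I := ∅) (J := ∅) (by simp) ∅ ∅
    (@MeasurableSet.empty _ (panelSigma e ∅)) (@MeasurableSet.empty _ (panelSigma e ∅)))

end PanelMixing

theorem pow_le_one_add_pow {x : ℝ} (hx : 0 ≤ x) {p q : ℕ} (hpq : p ≤ q) : x ^ p ≤ 1 + x ^ q := by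
  rcases le_total x 1 with h | h
  · have := pow_le_one₀ hx h (n := p)
    have : 0 ≤ x ^ q := by positivity
    linarith
  · have := pow_le_pow_right₀ h hpq
    linarith

/-- The truncation error `y⁻⁶` is more than enough for two summable factors, one for the cross
section and one for time. -/
theorem sq_div_pow_eight_le {y : ℝ} (hy : 1 ≤ y) : y ^ 2 / y ^ 8 ≤ 1 / y ^ 2 * (1 / y ^ 2) := by
  have : 0 < y := by linarith
  rw [div_mul_div_comm, div_le_div_iff₀ (by positivity) (by positivity)]
  have h2 : (1 : ℝ) ≤ y ^ 2 := one_le_pow₀ hy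
  calc y ^ 2 * (y ^ 2 * y ^ 2) = y ^ 6 * 1 := by ring
    _ ≤ y ^ 6 * y ^ 2 := by gcongr
    _ = 1 * 1 * y ^ 8 := by ring

namespace PanelArray

variable {Ω : Type*} [MeasurableSpace Ω] {P : Measure Ω} {K M : ℕ}

/-- The lag-`h` autocovariance of the errors of individual `i`. -/
noncomputable def acov (D : PanelArray Ω K) (n : ℕ) (i : Fin (D.N n)) (h : ℕ) : ℝ :=
  if hh : h < D.T n then D.SigN n i i * D.SigT n ⟨h, hh⟩ ⟨0, D.T_pos n⟩ else 0

variable {D : PanelArray Ω K}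

/-- Stationarity gives dependence on `s - t`, and symmetry of the Toeplitz matrix removes the sign.
-/
theorem BasicAssumptions.sigT_eq (hB : D.BasicAssumptions P M) (n : ℕ) (s t : Fin (D.T n)) :
    D.SigT n s t = D.SigT n ⟨lag s t, lag_lt s t⟩ ⟨0, D.T_pos n⟩ := by
  obtain ⟨γ, hγ, hS⟩ := hB.sigT_stationary n
  have hsymm : ∀ s t : Fin (D.T n), γ ((s : ℤ) - t) = γ ((t : ℤ) - s) := by
    intro s t
    have := (hγ (D.T n)).isHermitian.apply s t
    simpa using this.symm
  rw [hS, hS]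
  rcases le_total (t : ℤ) (s : ℤ) with h | h
  · congr 1
    simp only [lag]; omega
  · rw [hsymm]
    congr 1
    simp only [lag]; omega

theorem BasicAssumptions.sig_mul_eq_acov (hB : D.BasicAssumptions P M) (n : ℕ) (i : Fin (D.N n))
    (s t : Fin (D.T n)) : D.SigN n i i * D.SigT n s t = D.acov n i (lag s t) := by
  rw [acov, dif_pos (lag_lt s t), hB.sigT_eq n s t]

theorem BasicAssumptions.integral_mul (hB : D.BasicAssumptions P M) (n : ℕ) (i : Fin (D.N n))
    (s t : Fin (D.T n)) : ∫ ω, D.ε n ω i s * D.ε n ω i t ∂P = D.acov n i (lag s t) := by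
  have h := hB.covariance_eq n (i, s) (i, t)
  rw [← hB.sig_mul_eq_acov]
  simpa [covariance, hB.centered, Matrix.kroneckerMap_apply] using h

variable [IsProbabilityMeasure P]

/-- Mixing between single observations at distance `h`. The moment order `p` and the level `c` stay
free: `p = 8` serves the variance bounds, and `p = M` the sharp tails of the autocovariances. -/
theorem BasicAssumptions.abs_acov_le (hB : D.BasicAssumptions P M) {p : ℕ} (hp : 2 ≤ p) {B : ℝ}
    (hi : ∀ n i t, Integrable (fun ω => |D.ε n ω i t| ^ p) P)
    (hb : ∀ n i t, ∫ ω, |D.ε n ω i t| ^ p ∂P ≤ B) {n h : ℕ} (hh : h < D.T n) {c C : ℝ} (hc : 1 ≤ c)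
    (hα : alphaMixing P (D.ε n) h * c ^ p ≤ C) (i : Fin (D.N n)) :
    |D.acov n i h| ≤ (4 * C + 2 * B + 2 * B * (1 + B)) * (c ^ 2 / c ^ p) := by
  have h1 := abs_cov_le_of_mixing (P := P) (panelSigma_le (D.measurable_ε n) {(i, ⟨h, hh⟩)})
    (panelSigma_le (D.measurable_ε n) {(i, ⟨0, D.T_pos n⟩)}) (α := alphaMixing P (D.ε n) h)
    (fun A B hA hB => abs_measureReal_inter_sub_le_alphaMixing (r := h) (by
      rintro p hp q hq
      rw [Set.mem_singleton_iff] at hp hq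
      subst hp hq
      rw [panelDist_eq]
      refine le_max_of_le_right ?_
      simp [lag]) A B hA hB)
    (measurable_panelSigma (Set.mem_singleton _)) (measurable_panelSigma (Set.mem_singleton _))
    hp (hi n i _) (hb n i _) (hi n i _) (hb n i _) hc hα
  rw [hB.integral_mul, hB.centered, zero_mul, sub_zero] at h1
  simpa [lag] using h1

/-- Sixteen moments of the errors give eight moments of their products, so the truncated inequality
applies with `p = 8` and level one plus the distance. -/
theorem BasicAssumptions.panelMoments (hB : D.BasicAssumptions P M) (hM : 16 ≤ M) {C : ℝ}
    (hα : ∀ n (r : ℕ), alphaMixing P (D.ε n) r * (1 + (r : ℝ)) ^ 8 ≤ C) :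
    ∃ C₁ C₂ : ℝ, 0 ≤ C₁ ∧ 0 ≤ C₂ ∧ ∀ n, PanelMoments P (D.ε n) (D.acov n) C₁ C₂ := by
  obtain ⟨B₀, hB₀, hmom, -⟩ := hB.moments
  have hmeas := fun n i t => D.measurable_ε n i t
  have hpow : ∀ p, p ≤ M → ∀ n i t, Integrable (fun ω => |D.ε n ω i t| ^ p) P ∧
      ∫ ω, |D.ε n ω i t| ^ p ∂P ≤ 1 + B₀ := by
    intro p hp n i t
    have hle : ∀ ω, |D.ε n ω i t| ^ p ≤ 1 + |D.ε n ω i t| ^ M := fun ω =>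
      pow_le_one_add_pow (abs_nonneg _) hp
    have hi : Integrable (fun ω => 1 + |D.ε n ω i t| ^ M) P :=
      (integrable_const 1).add (hmom n i t).1
    have hi2 : Integrable (fun ω => |D.ε n ω i t| ^ p) P :=
      hi.mono' ((hmeas n i t).abs.pow_const p).aestronglyMeasurable
        (Eventually.of_forall fun ω => by
          rw [Real.norm_eq_abs, abs_of_nonneg (by positivity)]; exact hle ω)
    refine ⟨hi2, (integral_mono hi2 hi hle).trans ?_⟩
    rw [integral_add (integrable_const 1) (hmom n i t).1]
    simpa using (hmom n i t).2
  have hprod : ∀ n i s t, Integrable (fun ω => |D.ε n ω i s * D.ε n ω i t| ^ 8) P ∧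
      ∫ ω, |D.ε n ω i s * D.ε n ω i t| ^ 8 ∂P ≤ 1 + B₀ := by
    intro n i s t
    obtain ⟨i1, b1⟩ := hpow 16 hM n i s
    obtain ⟨i2, b2⟩ := hpow 16 hM n i t
    have hle : ∀ ω, |D.ε n ω i s * D.ε n ω i t| ^ 8
        ≤ (|D.ε n ω i s| ^ 16 + |D.ε n ω i t| ^ 16) / 2 := by
      intro ω
      rw [abs_mul, mul_pow]
      nlinarith [sq_nonneg (|D.ε n ω i s| ^ 8 - |D.ε n ω i t| ^ 8)]
    have hi : Integrable (fun ω => (|D.ε n ω i s| ^ 16 + |D.ε n ω i t| ^ 16) / 2) P :=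
      (i1.add i2).div_const 2
    have hi2 : Integrable (fun ω => |D.ε n ω i s * D.ε n ω i t| ^ 8) P :=
      hi.mono' (((hmeas n i s).mul (hmeas n i t)).abs.pow_const 8).aestronglyMeasurable
        (Eventually.of_forall fun ω => by
          rw [Real.norm_eq_abs, abs_of_nonneg (by positivity)]; exact hle ω)
    refine ⟨hi2, (integral_mono hi2 hi hle).trans ?_⟩
    rw [integral_div, integral_add i1 i2]
    linarith
  have hLp : ∀ n i s t, MemLp (fun ω => D.ε n ω i s * D.ε n ω i t) 2 P := by
    intro n i s t
    have hm : Measurable fun ω => D.ε n ω i s * D.ε n ω i t := (hmeas n i s).mul (hmeas n i t)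
    rw [memLp_two_iff_integrable_sq hm.aestronglyMeasurable]
    refine ((integrable_const 1).add (hprod n i s t).1).mono'
      (hm.pow_const 2).aestronglyMeasurable (Eventually.of_forall fun ω => ?_)
    rw [Real.norm_eq_abs, abs_of_nonneg (sq_nonneg _), ← sq_abs]
    exact pow_le_one_add_pow (abs_nonneg _) (by norm_num)
  have hC0 : 0 ≤ C := by
    refine le_trans ?_ (hα 0 0)
    have := alphaMixing_nonneg (P := P) (e := D.ε 0) 0
    positivity
  set k := 4 * C + 2 * (1 + B₀) + 2 * (1 + B₀) * (1 + (1 + B₀)) with hk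
  have hk0 : 0 ≤ k := by positivity
  refine ⟨k, k, hk0, hk0, fun n => ⟨hmeas n, hLp n, hB.integral_mul n, ?_, ?_⟩⟩
  · intro i h hh
    have hc : (1 : ℝ) ≤ 1 + h := by have : (0 : ℝ) ≤ h := Nat.cast_nonneg h; linarith
    refine (hB.abs_acov_le (p := 8) (by norm_num) (fun n i t => (hpow 8 (by omega) n i t).1)
      (fun n i t => (hpow 8 (by omega) n i t).2) hh hc (hα n h) i).trans ?_
    rw [div_eq_mul_one_div k]
    refine mul_le_mul_of_nonneg_left ((sq_div_pow_eight_le hc).trans ?_) hk0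
    refine mul_le_of_le_one_left (by positivity) ?_
    rw [div_le_one (by positivity)]
    exact one_le_pow₀ hc
  · intro i j s t s' t'
    -- The distance in the maximum norm between the index sets of the two products.
    set d : ℕ := max (lag i j) (min (min (lag s s') (lag s t')) (min (lag t s') (lag t t'))) with hd
    have hc : (1 : ℝ) ≤ 1 + d := by have : (0 : ℝ) ≤ d := Nat.cast_nonneg d; linarith
    have h1 := abs_cov_le_of_mixing (P := P) (panelSigma_le (D.measurable_ε n) {(i, s), (i, t)})
      (panelSigma_le (D.measurable_ε n) {(j, s'), (j, t')}) (α := alphaMixing P (D.ε n) d)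
      (fun A B hA hB => abs_measureReal_inter_sub_le_alphaMixing (r := d) (by
        rintro p hp q hq
        rw [panelDist_eq, hd]
        simp only [Set.mem_insert_iff, Set.mem_singleton_iff] at hp hq
        rcases hp with rfl | rfl <;> rcases hq with rfl | rfl <;>
          exact max_le_max le_rfl (by simp)) A B hA hB)
      (U := fun ω => D.ε n ω i s * D.ε n ω i t) (V := fun ω => D.ε n ω j s' * D.ε n ω j t')
      ((measurable_panelSigma (by simp)).mul (measurable_panelSigma (by simp)))
      ((measurable_panelSigma (by simp)).mul (measurable_panelSigma (by simp)))
      (p := 8) (by norm_num) (hprod n i s t).1 (hprod n i s t).2 (hprod n j s' t').1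
      (hprod n j s' t').2 hc (hα n d)
    have h2 := covariance_eq_sub (hLp n i s t) (hLp n j s' t')
    rw [covariance] at h2
    simp only [Pi.mul_apply, hB.integral_mul] at h2 h1
    rw [h2]
    refine h1.trans (mul_le_mul_of_nonneg_left ((sq_div_pow_eight_le hc).trans ?_) hk0)
    have hanti : ∀ a : ℕ, a ≤ d → 1 / (1 + (d : ℝ)) ^ 2 ≤ 1 / (1 + (a : ℝ)) ^ 2 := by
      intro a ha
      have : (a : ℝ) ≤ d := by exact_mod_cast ha
      gcongr
    refine mul_le_mul (hanti _ (le_max_left _ _)) ?_ (by positivity) (lagDecay_nonneg _ _)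
    have n1 := lagDecay_nonneg s s'
    have n2 := lagDecay_nonneg s t'
    have n3 := lagDecay_nonneg t s'
    have n4 := lagDecay_nonneg t t'
    -- The smallest of the four time lags is at most `d`, so the corresponding summand of
    -- `pairDecay` alone dominates the second factor.
    have hmin : lag s s' ≤ d ∨ lag s t' ≤ d ∨ lag t s' ≤ d ∨ lag t t' ≤ d := by omega
    unfold pairDecay
    rcases hmin with h | h | h | h
    · have := hanti _ h
      rw [← lagDecay] at this; linarith
    · have := hanti _ h
      rw [← lagDecay] at this; linarith
    · have := hanti _ h
      rw [← lagDecay] at this; linarith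
    · have := hanti _ h
      rw [← lagDecay] at this; linarith

end PanelArray

/-! ### From conditional to unconditional stochastic orders -/

section StochasticOrder

open scoped ENNReal

variable {Ω : Type*} [MeasurableSpace Ω] {P : Measure Ω}

/-- Markov's inequality for the conditional probability, whose mean is `P E`. -/
theorem measure_condProb_gt_le {Ω : Type*} {m m0 : MeasurableSpace Ω} {P : Measure Ω}
    [IsProbabilityMeasure P] (hm : m ≤ m0) (E : Set Ω) {δ : ℝ} (hδ : 0 < δ) : P {ω | δ < (P⟦E | m⟧) ω} ≤ P E / ENNReal.ofReal δ := by
  by_cases hE : Integrable (E.indicator fun _ => (1 : ℝ)) P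
  · have h0 : 0 ≤ᵐ[P] P⟦E | m⟧ := condExp_nonneg (Eventually.of_forall fun ω =>
      Set.indicator_nonneg (fun _ _ => zero_le_one) _)
    have h1 := mul_meas_ge_le_lintegral₀ (μ := P)
      (f := fun ω => ENNReal.ofReal ((P⟦E | m⟧) ω)) integrable_condExp.aemeasurable.ennreal_ofReal
      (ENNReal.ofReal δ)
    rw [← ofReal_integral_eq_lintegral_ofReal integrable_condExp h0, integral_condExp hm,
      ofReal_integral_eq_lintegral_ofReal hE (Eventually.of_forall fun ω =>
        Set.indicator_nonneg (fun _ _ => zero_le_one) _)] at h1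
    have h2 : ∫⁻ ω, ENNReal.ofReal (E.indicator (fun _ => (1 : ℝ)) ω) ∂P ≤ P E := by
      refine le_trans (lintegral_mono fun ω => ?_) (lintegral_indicator_one_le E)
      by_cases h : ω ∈ E <;> simp [h]
    rw [ENNReal.le_div_iff_mul_le (Or.inl (by simpa using hδ)) (Or.inl ENNReal.ofReal_ne_top),
      mul_comm]
    refine le_trans ?_ (h1.trans h2)
    gcongr
    exact fun h => ENNReal.ofReal_le_ofReal (le_of_lt h)
  -- `E` need not be measurable. If its indicator is not integrable, the conditional expectation is
  -- zero by convention and never exceeds `δ`.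
  · rw [condExp_of_not_integrable hE]
    have : {ω : Ω | δ < (0 : Ω → ℝ) ω} = ∅ := by
      ext ω; simp [hδ.le]
    rw [this]; simp

/-- Tails of `Z n` of order `r n`, up to events of vanishing probability. -/
def TailBound (P : Measure Ω) (Z : ℕ → Ω → ℝ) (r : ℕ → ℝ) : Prop :=
  ∃ (A : ℝ) (p : ℕ → ℝ≥0∞), 0 ≤ A ∧ Tendsto p atTop (𝓝 0) ∧
    ∀ᶠ n in atTop, ∀ l : ℝ, 0 < l → P {ω | l < |Z n ω|} ≤ p n + ENNReal.ofReal (A * r n / l)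

theorem TailBound.mono {Z : ℕ → Ω → ℝ} {r r' : ℕ → ℝ} (h : TailBound P Z r) {C : ℝ} (hC : 0 ≤ C)
    (hr : ∀ᶠ n in atTop, r n ≤ C * r' n) : TailBound P Z r' := by
  obtain ⟨A, p, hA, hp, hb⟩ := h
  refine ⟨A * C, p, by positivity, hp, ?_⟩
  filter_upwards [hb, hr] with n hn hrn l hl
  refine (hn l hl).trans ?_
  gcongr p n + ENNReal.ofReal (?_ / l)
  rw [mul_assoc]
  exact mul_le_mul_of_nonneg_left hrn hA

variable [IsProbabilityMeasure P] {E : ℕ → Type*} [∀ n, MeasurableSpace (E n)] {Y : ∀ n, Ω → E n}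

/-- The choice `l = C r n` leaves `p n + A / C`; the first term disappears in the limsup and the
second as `C → ∞`. -/
theorem TailBound.isCondBigOP {Z : ℕ → Ω → ℝ} {r : ℕ → ℝ} (h : TailBound P Z r)
    (hr : ∀ᶠ n in atTop, 0 < r n) (hY : ∀ n, Measurable (Y n)) : IsCondBigOP P Y Z r := by
  obtain ⟨A, p, hA, hp, hb⟩ := h
  intro δ hδ
  have hδ' : ENNReal.ofReal δ ≠ 0 := by simpa using hδ
  have key : ∀ C : ℝ, 0 < C → limsup (fun n : ℕ =>
      P {ω | δ < (P⟦{ω' | C < |Z n ω'| / r n} | MeasurableSpace.comap (Y n) inferInstance⟧) ω})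
      atTop ≤ ENNReal.ofReal (A / C) / ENNReal.ofReal δ := by
    intro C hC
    have hlim : Tendsto (fun n => (p n + ENNReal.ofReal (A / C)) / ENNReal.ofReal δ) atTop
        (𝓝 ((0 + ENNReal.ofReal (A / C)) / ENNReal.ofReal δ)) :=
      ENNReal.Tendsto.div_const (hp.add tendsto_const_nhds) (Or.inr hδ')
    rw [zero_add] at hlim
    rw [← hlim.limsup_eq]
    refine limsup_le_limsup ?_
    filter_upwards [hb, hr] with n hn hrn
    refine (measure_condProb_gt_le (hY n).comap_le _ hδ).trans ?_
    gcongr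
    have hset : {ω' | C < |Z n ω'| / r n} = {ω' | C * r n < |Z n ω'|} := by
      ext ω'; simp only [Set.mem_ofPred_eq, lt_div_iff₀ hrn]
    rw [hset]
    refine (hn (C * r n) (by positivity)).trans (le_of_eq ?_)
    congr 2
    field_simp
  have hz : Tendsto (fun C : ℝ => ENNReal.ofReal (A / C) / ENNReal.ofReal δ) atTop (𝓝 0) := by
    have h1 : Tendsto (fun C : ℝ => A / C) atTop (𝓝 0) := tendsto_const_nhds.div_atTop tendsto_id
    have h2 := ENNReal.Tendsto.div_const (ENNReal.tendsto_ofReal h1)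
      (Or.inr hδ' : ENNReal.ofReal 0 ≠ 0 ∨ ENNReal.ofReal δ ≠ 0)
    simpa using h2
  refine tendsto_of_tendsto_of_tendsto_of_le_of_le' tendsto_const_nhds hz
    (Eventually.of_forall fun _ => bot_le) ?_
  filter_upwards [eventually_gt_atTop 0] with C hC
  exact key C hC

theorem TailBound.isCondLittleOP {Z : ℕ → Ω → ℝ} {r a : ℕ → ℝ} (h : TailBound P Z r)
    (ha : ∀ n, 0 < a n) (hra : Tendsto (fun n => r n / a n) atTop (𝓝 0))
    (hY : ∀ n, Measurable (Y n)) : IsCondLittleOP P Y Z a := by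
  obtain ⟨A, p, hA, hp, hb⟩ := h
  intro C δ hC hδ
  have hδ' : ENNReal.ofReal δ ≠ 0 := by simpa using hδ
  have hlim : Tendsto (fun n => (p n + ENNReal.ofReal (A / C * (r n / a n))) / ENNReal.ofReal δ)
      atTop (𝓝 0) := by
    have h1 := ENNReal.tendsto_ofReal (hra.const_mul (A / C))
    have h2 := ENNReal.Tendsto.div_const (hp.add h1)
      (Or.inr hδ' : 0 + ENNReal.ofReal (A / C * 0) ≠ 0 ∨ ENNReal.ofReal δ ≠ 0)
    simpa using h2
  refine tendsto_of_tendsto_of_tendsto_of_le_of_le' tendsto_const_nhds hlim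
    (Eventually.of_forall fun _ => bot_le) ?_
  filter_upwards [hb] with n hn
  have han := ha n
  refine (measure_condProb_gt_le (hY n).comap_le _ hδ).trans ?_
  gcongr
  have hset : {ω' | C < |Z n ω'| / a n} = {ω' | C * a n < |Z n ω'|} := by
    ext ω'; simp only [Set.mem_ofPred_eq, lt_div_iff₀ han]
  rw [hset]
  refine (hn (C * a n) (by positivity)).trans (le_of_eq ?_)
  congr 2
  field_simp

/-- For independent `e` and `X`, a bound that holds for every fixed value of `X` in `A` holds for
the joint probability. -/
theorem measure_le_of_indepFun {α β : Type*} [MeasurableSpace α] [MeasurableSpace β]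
    {e : Ω → α} {X : Ω → β} (he : Measurable e) (hX : Measurable X) (hind : IndepFun e X P)
    {S : Set (α × β)} (hS : MeasurableSet S) {A : Set β} (hA : MeasurableSet A) {ζ : ℝ≥0∞}
    (hζ : ∀ x ∈ A, P {ω | (e ω, x) ∈ S} ≤ ζ) : P {ω | X ω ∈ A ∧ (e ω, X ω) ∈ S} ≤ ζ := by
  have hmap := (indepFun_iff_map_prod_eq_prod_map_map he.aemeasurable hX.aemeasurable).1 hind
  have hS' : MeasurableSet (S ∩ Prod.snd ⁻¹' A) := hS.inter (measurable_snd hA)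
  have : IsProbabilityMeasure (P.map e) := Measure.isProbabilityMeasure_map he.aemeasurable
  have : IsProbabilityMeasure (P.map X) := Measure.isProbabilityMeasure_map hX.aemeasurable
  have h1 : P {ω | X ω ∈ A ∧ (e ω, X ω) ∈ S} = (P.map fun ω => (e ω, X ω)) (S ∩ Prod.snd ⁻¹' A) := by
    rw [Measure.map_apply (he.prodMk hX) hS']
    congr 1
    ext ω
    simp [and_comm]
  rw [h1, hmap, Measure.prod_apply_symm hS']
  calc _ ≤ ∫⁻ _, ζ ∂(P.map X) := by
        refine lintegral_mono fun x => ?_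
        by_cases hx : x ∈ A
        · refine le_trans ?_ (hζ x hx)
          have hm : MeasurableSet ((fun y => (y, x)) ⁻¹' (S ∩ Prod.snd ⁻¹' A)) :=
            measurable_prodMk_right hS'
          rw [Measure.map_apply he hm]
          exact measure_mono fun ω hω => hω.1
        · have : (fun y : α => (y, x)) ⁻¹' (S ∩ Prod.snd ⁻¹' A) = ∅ := by
            ext y; simp [hx]
          rw [this]; simp
    _ = ζ := by simp

end StochasticOrder

/-! ### Well-conditioned regressors -/

section GoodRegressors

open Matrix

theorem frobNorm_eq {m n : ℕ} (A : Matrix (Fin m) (Fin n) ℝ) :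
    frobNorm A = √(∑ i, ∑ j, A i j ^ 2) := by
  rw [frobNorm, frobenius_norm_def, Real.sqrt_eq_rpow]
  simp

theorem euclNorm_eq {m : ℕ} (v : Fin m → ℝ) : euclNorm v = √(v ⬝ᵥ v) := by
  rw [euclNorm, EuclideanSpace.norm_eq]
  simp [dotProduct, sq]

theorem abs_entry_le_frobNorm {m n : ℕ} (A : Matrix (Fin m) (Fin n) ℝ) (i : Fin m) (j : Fin n) :
    |A i j| ≤ frobNorm A := by
  rw [frobNorm_eq]
  refine Real.abs_le_sqrt ?_
  calc A i j ^ 2 ≤ ∑ j, A i j ^ 2 :=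
        Finset.single_le_sum (f := fun j => A i j ^ 2) (fun _ _ => sq_nonneg _) (Finset.mem_univ j)
    _ ≤ _ := Finset.single_le_sum (f := fun i => ∑ j, A i j ^ 2)
        (fun _ _ => Finset.sum_nonneg fun _ _ => sq_nonneg _) (Finset.mem_univ i)

theorem abs_quadratic_le_frobNorm {m : ℕ} (A : Matrix (Fin m) (Fin m) ℝ) (v : Fin m → ℝ) :
    |v ⬝ᵥ (A *ᵥ v)| ≤ frobNorm A * (v ⬝ᵥ v) := by
  have h1 : v ⬝ᵥ (A *ᵥ v) = ∑ p : Fin m × Fin m, A p.1 p.2 * (v p.1 * v p.2) := by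
    rw [Fintype.sum_prod_type]
    simp only [dotProduct, mulVec, Finset.mul_sum]
    exact Finset.sum_congr rfl fun i _ => Finset.sum_congr rfl fun j _ => by ring
  have h2 := Finset.sum_mul_sq_le_sq_mul_sq Finset.univ (fun p : Fin m × Fin m => A p.1 p.2)
    (fun p => v p.1 * v p.2)
  have h3 : ∑ p : Fin m × Fin m, (v p.1 * v p.2) ^ 2 = (v ⬝ᵥ v) ^ 2 := by
    rw [Fintype.sum_prod_type, dotProduct, sq, Finset.sum_mul_sum]
    exact Finset.sum_congr rfl fun i _ => Finset.sum_congr rfl fun j _ => by ring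
  rw [h3, ← h1, Fintype.sum_prod_type] at h2
  rw [frobNorm_eq]
  have h4 := Real.abs_le_sqrt h2
  rwa [Real.sqrt_mul (Finset.sum_nonneg fun _ _ => Finset.sum_nonneg fun _ _ => sq_nonneg _),
    Real.sqrt_sq (dotProduct_self_nonneg' v)] at h4

/-- Subtracting `c` times the identity shifts the spectrum by `c`, so the difference is positive
semidefinite. -/
theorem le_quadratic_of_le_eigenvalues {m : ℕ} {Q : Matrix (Fin m) (Fin m) ℝ}
    (hQ : Q.IsHermitian) {c : ℝ} (hc : ∀ k, c ≤ hQ.eigenvalues k) (v : Fin m → ℝ) :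
    c * (v ⬝ᵥ v) ≤ v ⬝ᵥ (Q *ᵥ v) := by
  have hpsd : (Q - algebraMap ℝ (Matrix (Fin m) (Fin m) ℝ) c).PosSemidef := by
    rw [posSemidef_iff_isHermitian_and_spectrum_nonneg]
    refine ⟨hQ.sub ?_, ?_⟩
    · rw [algebraMap_eq_diagonal]; exact isHermitian_diagonal _
    · rw [← spectrum.sub_singleton_eq, hQ.spectrum_real_eq_range_eigenvalues]
      rintro x ⟨y, ⟨k, rfl⟩, z, hz, rfl⟩
      rw [Set.mem_singleton_iff] at hz
      subst hz
      exact sub_nonneg.2 (hc k)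
  have := hpsd.dotProduct_mulVec_nonneg v
  rw [sub_mulVec, dotProduct_sub, Algebra.algebraMap_eq_smul_one, smul_mulVec, one_mulVec, dotProduct_smul,
    star_trivial, smul_eq_mul] at this
  linarith

/-- A perturbation of size `c/2` lowers the quadratic form by at most half of its lower bound. The
trace consists of `K` diagonal entries, each at most `c' + c/2`. -/
theorem gramBounds_of_frobNorm_le {T K : ℕ} (hT : 0 < T) {x : Matrix (Fin T) (Fin K) ℝ}
    {Q : Matrix (Fin K) (Fin K) ℝ} (hQ : Q.IsHermitian) {c c' : ℝ}
    (hc : ∀ k, c ≤ hQ.eigenvalues k) (hc' : frobNorm Q ≤ c')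
    (hx : frobNorm ((1 / (T : ℝ)) • (xᵀ * x) - Q) ≤ c / 2) :
    GramBounds x (c / 2) (K * (c' + c / 2)) := by
  have hT' : (0 : ℝ) < T := by exact_mod_cast hT
  refine ⟨fun v => ?_, ?_⟩
  · have h1 := le_quadratic_of_le_eigenvalues hQ hc v
    have h2 := (abs_le.1 (abs_quadratic_le_frobNorm ((1 / (T : ℝ)) • (xᵀ * x) - Q) v)).1
    rw [sub_mulVec, dotProduct_sub, smul_mulVec, dotProduct_smul, smul_eq_mul] at h2
    have h3 := mul_le_mul_of_nonneg_right hx (dotProduct_self_nonneg' v)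
    have h4 : c / 2 * (v ⬝ᵥ v) ≤ 1 / (T : ℝ) * (v ⬝ᵥ ((xᵀ * x) *ᵥ v)) := by linarith
    have h5 := mul_le_mul_of_nonneg_left h4 hT'.le
    rw [← mul_assoc, ← mul_assoc, mul_one_div_cancel hT'.ne', one_mul] at h5
    linarith
  · have h1 : ∀ k, ∑ t, x t k ^ 2 ≤ (c' + c / 2) * T := by
      intro k
      have h2 := abs_le.1 (abs_entry_le_frobNorm ((1 / (T : ℝ)) • (xᵀ * x) - Q) k k)
      have h3 := abs_le.1 (abs_entry_le_frobNorm Q k k)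
      have h4 : ((1 / (T : ℝ)) • (xᵀ * x) - Q) k k = (∑ t, x t k ^ 2) / T - Q k k := by
        simp only [Matrix.sub_apply, Matrix.smul_apply, mul_apply, transpose_apply, smul_eq_mul, sq]
        ring
      rw [h4] at h2
      have h5 : (∑ t, x t k ^ 2) / T ≤ c' + c / 2 := by linarith [h2.2, h3.2]
      rwa [div_le_iff₀ hT'] at h5
    calc _ ≤ ∑ _k : Fin K, (c' + c / 2) * T := Finset.sum_le_sum fun k _ => h1 k
      _ = _ := by simp; ring

end GoodRegressors

/-! ### Joint measurability in regressors and errors, needed for Fubini. -/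

section Measurability

open Matrix

variable {N T K : ℕ}

theorem measurable_gram_entry (i j : Fin K) :
    Measurable fun x : Fin T → Fin K → ℝ => ((of x)ᵀ * of x) i j := by
  simp only [mul_apply, transpose_apply, of_apply]
  fun_prop

/-- The inverse is the adjugate times the inverted determinant, with value zero at singular
matrices, so no invertibility is needed. -/
theorem measurable_gram_inv_entry (i j : Fin K) :
    Measurable fun x : Fin T → Fin K → ℝ => ((of x)ᵀ * of x)⁻¹ i j := by
  have hc : Continuous fun x : Fin T → Fin K → ℝ => (of x)ᵀ * of x := by
    refine continuous_matrix fun a b => ?_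
    simp only [mul_apply, transpose_apply, of_apply]
    fun_prop
  have h1 : Measurable fun x : Fin T → Fin K → ℝ => ((of x)ᵀ * of x).det :=
    hc.matrix_det.measurable
  have h2 : Measurable fun x : Fin T → Fin K → ℝ => ((of x)ᵀ * of x).adjugate i j :=
    (hc.matrix_adjugate.matrix_elem i j).measurable
  simp only [inv_def, Ring.inverse_eq_inv', Matrix.smul_apply, smul_eq_mul]
  exact h1.inv.mul h2

theorem measurable_olsWeight {E : Type*} [MeasurableSpace E] {x : E → Fin T → Fin K → ℝ}
    {z : E → Fin K → ℝ} (hx : Measurable x) (hz : ∀ k, Measurable fun a => z a k) (t : Fin T) :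
    Measurable fun a => olsWeight (of (x a)) (z a) t := by
  simp only [olsWeight, mulVec, dotProduct]
  refine Finset.measurable_fun_sum _ fun k _ => ?_
  refine Measurable.mul (by simp only [of_apply]; fun_prop) ?_
  refine Finset.measurable_fun_sum _ fun l _ => ?_
  exact ((measurable_gram_inv_entry k l).comp hx).mul (hz l)

theorem measurable_olsResid {E : Type*} [MeasurableSpace E] {x : E → Fin T → Fin K → ℝ}
    {e : E → Fin T → ℝ} (hx : Measurable x) (he : Measurable e) (t : Fin T) :
    Measurable fun a => olsResid (of (x a)) (e a) t := by
  simp only [olsResid, Pi.sub_apply]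
  refine Measurable.sub (by fun_prop) (measurable_olsWeight hx (fun k => ?_) t)
  simp only [mulVec, dotProduct, transpose_apply, of_apply]
  fun_prop

theorem measurable_lagCov {E : Type*} [MeasurableSpace E] {r : E → Fin T → ℝ}
    (hr : ∀ t, Measurable fun a => r a t) (h : ℕ) : Measurable fun a => lagCov K (r a) h := by
  unfold lagCov
  exact (Finset.measurable_fun_sum _ fun t _ => (hr _).mul (hr _)).div_const _

theorem measurable_plugInError {E : Type*} [MeasurableSpace E] {x : E → Fin T → Fin K → ℝ}
    {e : E → Fin T → ℝ} (hx : Measurable x) (he : Measurable e) (z : Fin K → ℝ) (g : ℕ → ℝ)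
    (m : ℕ) : Measurable fun a => plugInError (of (x a)) z g m (e a) := by
  have hw : ∀ t, Measurable fun a => olsWeight (of (x a)) z t :=
    measurable_olsWeight hx fun _ => measurable_const
  have hl : ∀ h, Measurable fun a => lagCov K (olsResid (of (x a)) (e a)) h :=
    measurable_lagCov (measurable_olsResid hx he)
  unfold plugInError
  refine Finset.measurable_fun_sum _ fun s _ => Finset.measurable_fun_sum _ fun t _ => ?_
  refine Measurable.mul (Measurable.sub ?_ measurable_const) ((hw t).mul (hw s))
  by_cases h : lag s t < m
  · simp only [h, if_true]
    exact hl _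
  · simp only [h, if_false]
    exact measurable_const

theorem measurableSet_frobNorm_gram_le (Q : Matrix (Fin K) (Fin K) ℝ) (δ : ℝ) :
    MeasurableSet {x : Fin T → Fin K → ℝ |
      frobNorm ((1 / (T : ℝ)) • ((of x)ᵀ * of x) - Q) ≤ δ} := by
  refine measurableSet_le ?_ measurable_const
  simp only [frobNorm_eq, Matrix.sub_apply, Matrix.smul_apply, smul_eq_mul]
  refine Measurable.sqrt (Finset.measurable_fun_sum _ fun i _ =>
    Finset.measurable_fun_sum _ fun j _ => ?_)
  exact (((measurable_gram_entry i j).const_mul _).sub_const _).pow_const 2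

end Measurability

/-! ### Tail bound for the plug-in estimator -/

namespace PanelArray

open Matrix

variable {Ω : Type*} [MeasurableSpace Ω] {P : Measure Ω} {K M : ℕ} {D : PanelArray Ω K}

theorem measurable_allX (n : ℕ) : Measurable (D.allX n) :=
  measurable_pi_lambda _ fun i => measurable_pi_lambda _ fun t => measurable_pi_lambda _ fun k =>
    D.measurable_X n i t k

theorem measurable_errors (n : ℕ) : Measurable (D.ε n) :=
  measurable_pi_lambda _ fun i => measurable_pi_lambda _ fun t => D.measurable_ε n i t

/-- With an invertible Gram matrix the estimator is `β_i` plus the regression of the errors, so the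
slopes cancel in the residuals. -/
theorem resid_eq_olsResid {n : ℕ} {ω : Ω} {i : Fin (D.N n)} {c C : ℝ} (hc : 0 < c)
    (hX : GramBounds (D.X n ω i) c C) : D.resid n ω i = olsResid (D.X n ω i) (D.ε n ω i) := by
  have h1 : D.betaHat n ω i = D.β n i +
      (D.gram n ω i)⁻¹ *ᵥ ((D.X n ω i)ᵀ *ᵥ D.ε n ω i) := by
    rw [betaHat, y, mulVec_add, mulVec_add, mulVec_mulVec (D.β n i) (D.X n ω i)ᵀ, gram,
      hX.inv_mulVec_gram hc (D.T_pos n)]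
  rw [resid, h1, y, mulVec_add, olsResid, olsWeight, gram]
  abel

/-- The matrix is `w w'` for the prediction weights `w`, because the inverse Gram matrix is
symmetric; traces against it become quadratic forms. -/
theorem predMat_apply (n : ℕ) (ω : Ω) (i : Fin (D.N n)) (s t : Fin (D.T n)) :
    D.predMat n ω i s t = olsWeight (D.X n ω i) (D.xNew n i) s *
      olsWeight (D.X n ω i) (D.xNew n i) t := by
  have hsymm : ((D.gram n ω i)⁻¹)ᵀ = (D.gram n ω i)⁻¹ := by
    rw [transpose_nonsing_inv, gram, transpose_mul, transpose_transpose]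
  have h : D.predMat n ω i = vecMulVec (olsWeight (D.X n ω i) (D.xNew n i))
      (olsWeight (D.X n ω i) (D.xNew n i)) := by
    rw [predMat, mul_vecMulVec, vecMulVec_mul, vecMulVec_mul, ← mulVec_mulVec, vecMul_transpose,
      ← mulVec_transpose, hsymm]
    rfl
  rw [h, vecMulVec_apply]

theorem E1Hat_sub_E1_eq (hB : D.BasicAssumptions P M) {n : ℕ} {ω : Ω} {c C : ℝ} (hc : 0 < c)
    (hX : ∀ i, GramBounds (D.X n ω i) c C) (b : ℝ) :
    D.E1Hat n b ω - D.E1 n ω = (1 / (D.N n : ℝ)) * ∑ i,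
      plugInError (D.X n ω i) (D.xNew n i) (D.acov n i) ⌈b⌉₊ (D.ε n ω i) := by
  have h1 : ∀ i, (D.SigHat n ω b i * D.predMat n ω i).trace
      = ∑ s, ∑ t, (if lag s t < ⌈b⌉₊ then lagCov K (olsResid (D.X n ω i) (D.ε n ω i)) (lag s t)
          else 0) * (olsWeight (D.X n ω i) (D.xNew n i) t *
            olsWeight (D.X n ω i) (D.xNew n i) s) := by
    intro i
    simp only [trace, diag_apply, mul_apply, predMat_apply]
    refine Finset.sum_congr rfl fun s _ => Finset.sum_congr rfl fun t _ => ?_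
    congr 1
    -- Lags are natural numbers, so the real cutoff `b` acts as `⌈b⌉₊`.
    simp only [SigHat, of_apply, Nat.lt_ceil]
    rw [← resid_eq_olsResid hc (hX i)]
    rfl
  have h2 : D.E1 n ω = (1 / (D.N n : ℝ)) * ∑ i, ∑ s, ∑ t, D.acov n i (lag s t) *
      (olsWeight (D.X n ω i) (D.xNew n i) t * olsWeight (D.X n ω i) (D.xNew n i) s) := by
    rw [E1, Matrix.mul_sum, trace_sum, Finset.mul_sum]
    refine Finset.sum_congr rfl fun i _ => ?_
    rw [mul_smul_comm, trace_smul, smul_eq_mul, mul_assoc]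
    congr 1
    simp only [trace, diag_apply, mul_apply, predMat_apply, Finset.mul_sum]
    refine Finset.sum_congr rfl fun s _ => Finset.sum_congr rfl fun t _ => ?_
    rw [← hB.sig_mul_eq_acov]
    ring
  rw [h2, E1Hat, ← mul_sub, ← Finset.sum_sub_distrib]
  congr 1
  refine Finset.sum_congr rfl fun i _ => ?_
  rw [h1]
  simp only [plugInError, ← Finset.sum_sub_distrib, ← sub_mul]

theorem rate_pos {b : ℕ → ℝ} {n : ℕ} (hb : 0 < b n) : 0 < D.rate b n := by
  have hN : (0 : ℝ) < D.N n := by exact_mod_cast D.N_pos n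
  have hT : (0 : ℝ) < D.T n := by exact_mod_cast D.T_pos n
  unfold rate
  positivity

theorem targetRate_pos (n : ℕ) : 0 < D.targetRate n := by
  have hN : (0 : ℝ) < D.N n := by exact_mod_cast D.N_pos n
  have hT : (0 : ℝ) < D.T n := by exact_mod_cast D.T_pos n
  unfold targetRate
  positivity

variable [IsProbabilityMeasure P]

/-- Joins the pieces: off the event of badly conditioned Gram matrices, Fubini reduces to fixed
regressors. The type of mixing enters only through `Cα` and the tail sum `τ`. -/
theorem tailBound (hB : D.BasicAssumptions P M) (hM : 16 ≤ M) (hReg : D.RegressorConvergence P)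
    (hPred : D.BoundedPredictors) {Cα : ℝ}
    (hα : ∀ n (r : ℕ), alphaMixing P (D.ε n) r * (1 + (r : ℝ)) ^ 8 ≤ Cα)
    (hT : Tendsto (fun n => (D.T n : ℝ)) atTop atTop) {b : ℕ → ℝ} (hb : ∀ᶠ n in atTop, 1 ≤ b n)
    (hbT : Tendsto (fun n => b n / (D.T n : ℝ)) atTop (𝓝 0)) {τ : ℕ → ℝ}
    (hτ : ∀ᶠ n in atTop, ∀ i, ∑ h ∈ Finset.Ico ⌈b n⌉₊ (D.T n), |D.acov n i h| ≤ τ n) :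
    TailBound P (fun n ω => |D.E1Hat n (b n) ω - D.E1 n ω|)
      (fun n => D.rate b n + τ n / (D.T n : ℝ)) := by
  obtain ⟨C₁, C₂, hC₁, hC₂, hmom⟩ := hB.panelMoments hM hα
  obtain ⟨Q, c₁, c₂, hQ, hc₁, heig, hQn, hconv⟩ := hReg
  obtain ⟨c₃, hc₃, hx⟩ := hPred
  -- The absolute value makes the constant nonnegative without a sign condition on `c₂`.
  set C' : ℝ := K * (|c₂| + c₁ / 2) with hC'
  have hC'0 : 0 ≤ C' := by positivity
  set A₀ : ℝ := 2048 * C₂ * (c₃ ^ 2 / (c₁ / 2)) ^ 2 + 1 + 4 * (c₃ ^ 2 / (c₁ / 2)) *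
    (K * C₁ + 4 * C₁ * C' * (1 / (c₁ / 2) ^ 2 + 1 / (c₁ / 2) + 1)) + 2 * (c₃ ^ 2 / (c₁ / 2))
    with hA₀
  have hA₀0 : 0 ≤ A₀ := by positivity
  have hz : ∀ n i, D.xNew n i ⬝ᵥ D.xNew n i ≤ c₃ ^ 2 := by
    intro n i
    have := hx n i
    rw [euclNorm_eq] at this
    exact Real.sqrt_le_left hc₃.le |>.1 this
  -- The vanishing part is the probability that some Gram matrix is badly conditioned; the factor
  -- `2` pays for `⌈b⌉₊ ≤ 2 b`.
  refine ⟨2 * A₀, _, by positivity, hconv (c₁ / 2) (by positivity), ?_⟩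
  -- With `T ≥ 4 K` this gives `2 (⌈b⌉₊ + K) ≤ 4 b + 2 K ≤ T`.
  have hsmall : ∀ᶠ n in atTop, b n / (D.T n : ℝ) < 1 / 8 :=
    hbT.eventually (gt_mem_nhds (by norm_num))
  filter_upwards [hb, hτ, hsmall, hT.eventually_ge_atTop (4 * K)] with n hbn hτn hsn hTn l hl
  have hN' : (0 : ℝ) < D.N n := by exact_mod_cast D.N_pos n
  have hT' : (0 : ℝ) < D.T n := by exact_mod_cast D.T_pos n
  set m := ⌈b n⌉₊ with hm
  have hm1 : 1 ≤ m := Nat.one_le_ceil_iff.2 (by linarith)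
  have hm2 : (m : ℝ) ≤ 2 * b n := by
    have := Nat.ceil_lt_add_one (show 0 ≤ b n by linarith)
    rw [← hm] at this
    linarith
  have hmT : 2 * (m + K) ≤ D.T n := by
    rw [div_lt_iff₀ hT'] at hsn
    have : (2 : ℝ) * (m + K) ≤ D.T n := by linarith
    exact_mod_cast this
  set A : Set (Fin (D.N n) → Fin (D.T n) → Fin K → ℝ) :=
    {x | ∀ i, frobNorm ((1 / (D.T n : ℝ)) • ((of (x i))ᵀ * of (x i)) - Q n i) ≤ c₁ / 2} with hA
  have hAm : MeasurableSet A := by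
    have : A = ⋂ i, (fun x => x i) ⁻¹' {x : Fin (D.T n) → Fin K → ℝ |
        frobNorm ((1 / (D.T n : ℝ)) • ((of x)ᵀ * of x) - Q n i) ≤ c₁ / 2} := by
      ext x; simp [hA]
    rw [this]
    exact MeasurableSet.iInter fun i =>
      (measurable_pi_apply i) (measurableSet_frobNorm_gram_le (Q n i) (c₁ / 2))
  have hgood : ∀ x ∈ A, ∀ i, GramBounds (of (x i)) (c₁ / 2) C' := fun x hx i =>
    gramBounds_of_frobNorm_le (D.T_pos n) (hQ n i).isHermitian (heig n i)
      ((hQn n i).trans (le_abs_self _)) (hx i)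
  set F : (Fin (D.N n) → Fin (D.T n) → ℝ) × (Fin (D.N n) → Fin (D.T n) → Fin K → ℝ) → ℝ :=
    fun p => (1 / (D.N n : ℝ)) * ∑ i,
      plugInError (of (p.2 i)) (D.xNew n i) (D.acov n i) m (p.1 i) with hF
  have hFm : Measurable F := by
    refine (Finset.measurable_fun_sum _ fun i _ => ?_).const_mul _
    exact measurable_plugInError ((measurable_pi_apply i).comp measurable_snd)
      ((measurable_pi_apply i).comp measurable_fst) _ _ _
  have hrate : m / (D.T n : ℝ) ^ 2 + m / (√(D.N n : ℝ) * (D.T n : ℝ) ^ (3 / 2 : ℝ))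
      + τ n / D.T n ≤ 2 * (D.rate b n + τ n / D.T n) := by
    have hτ0 : 0 ≤ τ n := (Finset.sum_nonneg fun _ _ => abs_nonneg _).trans (hτn ⟨0, D.N_pos n⟩)
    have h1 : m / (D.T n : ℝ) ^ 2 ≤ 2 * (b n / (D.T n : ℝ) ^ 2) := by
      rw [← mul_div_assoc]; gcongr
    -- The argument yields the first power of `b` here; the exponent `7/4` only weakens it.
    have hb7 : b n ≤ b n ^ (7 / 4 : ℝ) := Real.self_le_rpow_of_one_le hbn (by norm_num)
    have h2 : m / (√(D.N n : ℝ) * (D.T n : ℝ) ^ (3 / 2 : ℝ))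
        ≤ 2 * (b n ^ (7 / 4 : ℝ) / (√(D.N n : ℝ) * (D.T n : ℝ) ^ (3 / 2 : ℝ))) := by
      rw [← mul_div_assoc]; gcongr; linarith
    have h3 : 0 ≤ τ n / D.T n := by positivity
    unfold rate
    linarith
  have hsub : {ω | l < |(|D.E1Hat n (b n) ω - D.E1 n ω|)|}
      ⊆ {ω | ∃ i, c₁ / 2 < frobNorm ((1 / (D.T n : ℝ)) • D.gram n ω i - Q n i)}
        ∪ {ω | D.allX n ω ∈ A ∧ (D.ε n ω, D.allX n ω) ∈ {p | l < |F p|}} := by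
    intro ω hω
    by_cases h : ∃ i, c₁ / 2 < frobNorm ((1 / (D.T n : ℝ)) • D.gram n ω i - Q n i)
    · exact Or.inl h
    · push Not at h
      have hXA : D.allX n ω ∈ A := h
      refine Or.inr ⟨hXA, ?_⟩
      have hω' : l < |(|D.E1Hat n (b n) ω - D.E1 n ω|)| := hω
      rw [abs_abs, E1Hat_sub_E1_eq hB (by positivity : 0 < c₁ / 2) (hgood _ hXA)] at hω'
      exact hω'
  refine (measure_mono hsub).trans ((measure_union_le _ _).trans ?_)
  gcongr
  refine measure_le_of_indepFun (measurable_errors n) (measurable_allX n) (hB.exogeneity n)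
    (measurableSet_lt measurable_const hFm.abs) hAm fun x hx => ?_
  have h1 := (hmom n).measure_plugInError_le hC₁ hC₂ (D.N_pos n) (D.T_pos n) hm1 hmT
    (by positivity : 0 < c₁ / 2) hC'0 (hgood x hx) (hz n) (by positivity) hτn hl
  rw [← ofReal_measureReal]
  refine ENNReal.ofReal_le_ofReal (h1.trans ?_)
  gcongr ?_ / l
  calc _ ≤ A₀ * (2 * (D.rate b n + τ n / D.T n)) := by gcongr
    _ = _ := by ring

/-! ### Decay of autocovariances -/

/-- The level `c = r^{a/M}` makes `α(r) c^M` bounded, and then `c² / c^M` is the claimed power of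
`r`. -/
theorem PolyMixing.abs_acov_le (hB : D.BasicAssumptions P M) (hM : 2 ≤ M) {a : ℝ} (ha : 0 ≤ a)
    (h : D.PolyMixing P a) : ∃ k : ℝ, 0 ≤ k ∧ ∀ n i (r : ℕ), 1 ≤ r → r < D.T n →
      |D.acov n i r| ≤ k * (r : ℝ) ^ (-a * (1 - 2 / (M : ℝ))) := by
  obtain ⟨C, hC, hα⟩ := h
  obtain ⟨B, hB0, hmom, -⟩ := hB.moments
  refine ⟨4 * C + 2 * B + 2 * B * (1 + B), by positivity, fun n i r hr hrT => ?_⟩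
  have hr0 : (0 : ℝ) < r := by exact_mod_cast hr
  have hr1 : (1 : ℝ) ≤ r := by exact_mod_cast hr
  have hM0 : (M : ℝ) ≠ 0 := by positivity
  have hpow : ((r : ℝ) ^ (a / M)) ^ M = (r : ℝ) ^ a := by
    rw [← Real.rpow_natCast, ← Real.rpow_mul hr0.le, div_mul_cancel₀ _ hM0]
  have hpow2 : ((r : ℝ) ^ (a / M)) ^ 2 = (r : ℝ) ^ (a / M * 2) := by
    rw [← Real.rpow_natCast, ← Real.rpow_mul hr0.le]; norm_num
  have := hB.abs_acov_le hM (fun n i t => (hmom n i t).1) (fun n i t => (hmom n i t).2) hrT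
    (c := (r : ℝ) ^ (a / M)) (C := C) (Real.one_le_rpow hr1 (by positivity)) (by
      rw [hpow]
      calc _ ≤ C * (r : ℝ) ^ (-a) * (r : ℝ) ^ a := by gcongr; exact hα n r hr
        _ = C := by rw [mul_assoc, ← Real.rpow_add hr0]; simp) i
  rw [hpow, hpow2, ← Real.rpow_sub hr0] at this
  convert this using 3
  field_simp
  ring

theorem PolyMixing.alphaMixing_mul_le {a : ℝ} (ha : 8 ≤ a) (h : D.PolyMixing P a) :
    ∃ C : ℝ, ∀ n (r : ℕ), alphaMixing P (D.ε n) r * (1 + (r : ℝ)) ^ 8 ≤ C := by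
  obtain ⟨C, hC, hα⟩ := h
  refine ⟨max 1 (C * 2 ^ 8), fun n r => ?_⟩
  rcases Nat.eq_zero_or_pos r with rfl | hr
  · refine le_max_of_le_left ?_
    simpa using alphaMixing_le_one (P := P) (e := D.ε n) 0
  · refine le_max_of_le_right ?_
    have hr1 : (1 : ℝ) ≤ r := by exact_mod_cast hr
    have hr0 : (0 : ℝ) < r := by linarith
    calc _ ≤ C * (r : ℝ) ^ (-8 : ℝ) * (2 * r) ^ 8 := by
          have : alphaMixing P (D.ε n) r ≤ C * (r : ℝ) ^ (-8 : ℝ) :=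
            (hα n r hr).trans (by gcongr)
          gcongr
          linarith
      _ = C * 2 ^ 8 := by
          rw [Real.rpow_neg hr0.le, mul_pow, show (8 : ℝ) = (8 : ℕ) by norm_num, Real.rpow_natCast]
          field_simp

/-- The level `c = ψ^{r/M}` gives the ratio `q = ψ^{2/M - 1}`, which is below one since `M > 2`. -/
theorem ExpMixing.abs_acov_le (hB : D.BasicAssumptions P M) (hM : 3 ≤ M) (h : D.ExpMixing P) :
    ∃ (k q : ℝ) (r₀ : ℕ), 0 ≤ k ∧ 0 < q ∧ q < 1 ∧ ∀ n i (r : ℕ), r₀ ≤ r → r < D.T n →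
      |D.acov n i r| ≤ k * q ^ r := by
  obtain ⟨ψ, r₀, hψ, hα⟩ := h
  obtain ⟨B, hB0, hmom, -⟩ := hB.moments
  have hψ0 : 0 < ψ := by linarith
  have hM3 : (3 : ℝ) ≤ M := by exact_mod_cast hM
  have hM0 : (M : ℝ) ≠ 0 := by positivity
  refine ⟨4 * 1 + 2 * B + 2 * B * (1 + B), ψ ^ (2 / (M : ℝ) - 1), r₀, by positivity, by positivity,
    Real.rpow_lt_one_of_one_lt_of_neg hψ ?_, fun n i r hr hrT => ?_⟩
  · rw [sub_neg, div_lt_one (by positivity)]; linarith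
  · have hpow : (ψ ^ ((r : ℝ) / M)) ^ M = ψ ^ (r : ℝ) := by
      rw [← Real.rpow_natCast, ← Real.rpow_mul hψ0.le, div_mul_cancel₀ _ hM0]
    have hpow2 : (ψ ^ ((r : ℝ) / M)) ^ 2 = ψ ^ ((r : ℝ) / M * 2) := by
      rw [← Real.rpow_natCast, ← Real.rpow_mul hψ0.le]; norm_num
    have := hB.abs_acov_le (by omega) (fun n i t => (hmom n i t).1) (fun n i t => (hmom n i t).2)
      hrT (c := ψ ^ ((r : ℝ) / M)) (C := 1) (Real.one_le_rpow hψ.le (by positivity)) (by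
        rw [hpow]
        calc _ ≤ ψ ^ (-(r : ℝ)) * ψ ^ (r : ℝ) := by gcongr; exact hα n r hr
          _ = 1 := by rw [← Real.rpow_add hψ0]; simp) i
    rw [hpow, hpow2, ← Real.rpow_sub hψ0] at this
    convert this using 2
    rw [← Real.rpow_natCast (ψ ^ _), ← Real.rpow_mul hψ0.le]
    congr 1
    field_simp

theorem ExpMixing.alphaMixing_mul_le (h : D.ExpMixing P) :
    ∃ C : ℝ, ∀ n (r : ℕ), alphaMixing P (D.ε n) r * (1 + (r : ℝ)) ^ 8 ≤ C := by
  obtain ⟨ψ, r₀, hψ, hα⟩ := h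
  have hψ0 : 0 < ψ := by linarith
  obtain ⟨C, hC⟩ := (tendsto_pow_const_mul_const_pow_of_abs_lt_one 8 (r := ψ⁻¹) (by
    rw [abs_of_pos (by positivity)]; exact inv_lt_one_of_one_lt₀ hψ)).bddAbove_range
  refine ⟨max ((1 + (r₀ : ℝ)) ^ 8) (ψ * C), fun n r => ?_⟩
  rcases lt_or_ge r r₀ with hr | hr
  · refine le_max_of_le_left ?_
    have hr' : (r : ℝ) ≤ r₀ := by exact_mod_cast hr.le
    calc _ ≤ 1 * (1 + (r₀ : ℝ)) ^ 8 := by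
          gcongr
          exact alphaMixing_le_one r
      _ = _ := one_mul _
  · refine le_max_of_le_right ?_
    -- Shifting by one turns `(1 + r)⁸` into a term of the bounded sequence `k⁸ ψ⁻ᵏ`, at the price
    -- of a factor `ψ`.
    have h1 : ((r + 1 : ℕ) : ℝ) ^ 8 * ψ⁻¹ ^ (r + 1) ≤ C := hC ⟨r + 1, rfl⟩
    have h2 : ψ ^ (-(r : ℝ)) = ψ * ψ⁻¹ ^ (r + 1) := by
      rw [Real.rpow_neg hψ0.le, Real.rpow_natCast, pow_succ, inv_pow]
      field_simp
    calc _ ≤ ψ ^ (-(r : ℝ)) * (1 + (r : ℝ)) ^ 8 := by gcongr; exact hα n r hr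
      _ = ψ * (((r + 1 : ℕ) : ℝ) ^ 8 * ψ⁻¹ ^ (r + 1)) := by rw [h2]; push_cast; ring
      _ ≤ ψ * C := by gcongr

end PanelArray

/-- Split off `h⁻²`, whose tail sum is at most `2 / m`; the remaining power is largest at `h = m`
because `κ ≥ 2`. -/
theorem sum_Ico_rpow_le {κ b : ℝ} (hκ : 2 ≤ κ) (hb : 0 < b) (T : ℕ) :
    ∑ h ∈ Finset.Ico ⌈b⌉₊ T, (h : ℝ) ^ (-κ) ≤ 2 * b ^ (-κ + 1) := by
  set m := ⌈b⌉₊ with hm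
  have hm1 : 1 ≤ m := Nat.one_le_ceil_iff.2 hb
  have hm0 : (0 : ℝ) < m := by exact_mod_cast hm1
  have hbm : b ≤ m := Nat.le_ceil b
  have h1 : ∑ h ∈ Finset.Ico m T, ((h : ℝ) ^ 2)⁻¹ ≤ 2 / m := by
    have := sum_Ioo_inv_sq_le (α := ℝ) (m - 1) T
    have hset : Finset.Ioo (m - 1) T = Finset.Ico m T := by
      ext h; simp only [Finset.mem_Ioo, Finset.mem_Ico]; omega
    rw [hset] at this
    have hc : ((m - 1 : ℕ) : ℝ) + 1 = m := by
      rw [Nat.cast_sub hm1]; simp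
    rwa [hc] at this
  calc ∑ h ∈ Finset.Ico m T, (h : ℝ) ^ (-κ)
      ≤ ∑ h ∈ Finset.Ico m T, (m : ℝ) ^ (2 - κ) * ((h : ℝ) ^ 2)⁻¹ := by
        refine Finset.sum_le_sum fun h hh => ?_
        have hmh : (m : ℝ) ≤ h := by exact_mod_cast (Finset.mem_Ico.1 hh).1
        have hh0 : (0 : ℝ) < h := hm0.trans_le hmh
        have e : (h : ℝ) ^ (-κ) = (h : ℝ) ^ (2 - κ) * ((h : ℝ) ^ 2)⁻¹ := by
          rw [← Real.rpow_natCast, ← Real.rpow_neg hh0.le, ← Real.rpow_add hh0]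
          congr 1
          push_cast
          ring
        rw [e]
        exact mul_le_mul_of_nonneg_right
          (Real.rpow_le_rpow_of_nonpos hm0 hmh (by linarith)) (by positivity)
    _ = (m : ℝ) ^ (2 - κ) * ∑ h ∈ Finset.Ico m T, ((h : ℝ) ^ 2)⁻¹ := by rw [Finset.mul_sum]
    _ ≤ (m : ℝ) ^ (2 - κ) * (2 / m) := by gcongr
    _ = 2 * (m : ℝ) ^ (-κ + 1) := by
        have : (m : ℝ) ^ (2 - κ) = (m : ℝ) ^ (-κ + 1) * m := by
          rw [← Real.rpow_add_one hm0.ne']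
          congr 1
          ring
        rw [this]
        field_simp
    _ ≤ 2 * b ^ (-κ + 1) := by
        gcongr 2 * ?_
        exact Real.rpow_le_rpow_of_nonpos hb hbm (by linarith)

/-! ### Rates -/

namespace PanelArray

variable {Ω : Type*} [MeasurableSpace Ω] {P : Measure Ω} {K M : ℕ} {D : PanelArray Ω K}

theorem one_le_T (n : ℕ) : (1 : ℝ) ≤ D.T n := by exact_mod_cast D.T_pos n

theorem one_le_N (n : ℕ) : (1 : ℝ) ≤ D.N n := by exact_mod_cast D.N_pos n

/-- Since `N ≥ 1`, `T^{-η}` is at most `N / T^η`; so the growth condition alone forces `T → ∞`. -/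
theorem tendsto_T_atTop {η : ℝ} (hη : 0 < η)
    (hNT : Tendsto (fun n => (D.N n : ℝ) / (D.T n : ℝ) ^ η) atTop (𝓝 0)) :
    Tendsto (fun n => (D.T n : ℝ)) atTop atTop := by
  have hpos : ∀ n, 0 < (D.T n : ℝ) ^ η := fun n => Real.rpow_pos_of_pos
    (zero_lt_one.trans_le (one_le_T n)) η
  have h1 : Tendsto (fun n => ((D.T n : ℝ) ^ η)⁻¹) atTop (𝓝 0) := by
    refine squeeze_zero (fun n => (inv_pos.2 (hpos n)).le) (fun n => ?_) hNT
    rw [inv_eq_one_div]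
    exact div_le_div_of_nonneg_right (one_le_N n) (hpos n).le
  have h2 : Tendsto (fun n => (D.T n : ℝ) ^ η) atTop atTop := by
    have h3 : Tendsto (fun n => ((D.T n : ℝ) ^ η)⁻¹) atTop (𝓝[>] 0) :=
      tendsto_nhdsWithin_iff.2 ⟨h1, Eventually.of_forall fun n => inv_pos.2 (hpos n)⟩
    exact h3.inv_tendsto_nhdsGT_zero.congr fun n => inv_inv _
  have h4 := (tendsto_rpow_atTop (inv_pos.2 hη)).comp h2
  refine h4.congr fun n => ?_
  simp only [Function.comp]
  rw [← Real.rpow_mul (zero_le_one.trans (one_le_T n)), mul_inv_cancel₀ hη.ne', Real.rpow_one]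

theorem tendsto_sqrt_N_mul_rpow {η : ℝ}
    (hNT : Tendsto (fun n => (D.N n : ℝ) / (D.T n : ℝ) ^ η) atTop (𝓝 0)) {θ : ℝ}
    (hθ : θ ≤ -(η / 2)) :
    Tendsto (fun n => √(D.N n : ℝ) * (D.T n : ℝ) ^ θ) atTop (𝓝 0) := by
  have h1 : Tendsto (fun n => √((D.N n : ℝ) / (D.T n : ℝ) ^ η)) atTop (𝓝 0) := by
    simpa using hNT.sqrt
  refine squeeze_zero (fun n => by positivity) (fun n => ?_) h1
  have hT0 : (0 : ℝ) ≤ D.T n := zero_le_one.trans (one_le_T n)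
  rw [Real.sqrt_div (Nat.cast_nonneg _), div_eq_mul_inv, Real.sqrt_eq_rpow ((D.T n : ℝ) ^ η),
    ← Real.rpow_mul hT0, ← Real.rpow_neg hT0]
  refine mul_le_mul_of_nonneg_left ?_ (Real.sqrt_nonneg _)
  exact Real.rpow_le_rpow_of_exponent_le (one_le_T n) (by linarith)

/-- The quotient is `√N T^{ρ-1} + T^{7ρ/4 - 1/2}`. The two bounds on `ρ` make these two terms
vanish. -/
theorem tendsto_rate_div_targetRate {η ρ : ℝ} (hη : 0 < η)
    (hNT : Tendsto (fun n => (D.N n : ℝ) / (D.T n : ℝ) ^ η) atTop (𝓝 0))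
    (hρ : ρ < min (1 - η / 2) (2 / 7)) :
    Tendsto (fun n => D.rate (fun m => (D.T m : ℝ) ^ ρ) n / D.targetRate n) atTop (𝓝 0) := by
  have hT := tendsto_T_atTop hη hNT
  have hρ1 := hρ.trans_le (min_le_left _ _)
  have hρ2 := hρ.trans_le (min_le_right _ _)
  have h1 := tendsto_sqrt_N_mul_rpow hNT (θ := ρ - 1) (by linarith)
  have h2 := (tendsto_rpow_neg_atTop (y := 1 / 2 - ρ * (7 / 4)) (by linarith)).comp hT
  have h3 := h1.add h2
  rw [add_zero] at h3
  refine h3.congr fun n => ?_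
  have hT0 : (0 : ℝ) < D.T n := zero_lt_one.trans_le (one_le_T n)
  have hN0 : (0 : ℝ) < D.N n := zero_lt_one.trans_le (one_le_N n)
  have e1 : (D.T n : ℝ) ^ (-(1 / 2 - ρ * (7 / 4))) =
      (D.T n : ℝ) ^ (ρ * (7 / 4)) * D.T n / (D.T n : ℝ) ^ (3 / 2 : ℝ) := by
    rw [← Real.rpow_add_one hT0.ne', ← Real.rpow_sub hT0]
    congr 1
    ring
  simp only [Function.comp, rate, targetRate]
  rw [e1, ← Real.rpow_mul hT0.le, Real.rpow_sub_one hT0.ne']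
  field_simp

theorem tendsto_polyRate_div_targetRate {η ρ a : ℝ} (hη : 0 < η)
    (hNT : Tendsto (fun n => (D.N n : ℝ) / (D.T n : ℝ) ^ η) atTop (𝓝 0))
    (hρ : ρ < min (1 - η / 2) (2 / 7)) (ha : 3 ≤ a * (1 - 2 / (M : ℝ)))
    (hρ' : η / (a * (1 - 2 / (M : ℝ)) + 1) < ρ) :
    Tendsto (fun n => D.polyRate M a (fun m => (D.T m : ℝ) ^ ρ) n / D.targetRate n)
      atTop (𝓝 0) := by
  set κ := a * (1 - 2 / (M : ℝ)) with hκ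
  rw [div_lt_iff₀ (by linarith)] at hρ'
  have hρ0 : 0 < ρ := by
    by_contra! h
    nlinarith
  -- The requirement is `ρ (κ - 1) ≥ η / 2`. It follows from `ρ (κ + 1) > η` since `κ ≥ 3` gives `κ
  -- - 1 ≥ (κ + 1) / 2`.
  have h1 := tendsto_sqrt_N_mul_rpow hNT (θ := ρ * (-κ + 1)) (by nlinarith)
  have h3 := (tendsto_rate_div_targetRate hη hNT hρ).add h1
  rw [add_zero] at h3
  refine h3.congr fun n => ?_
  have hT0 : (0 : ℝ) < D.T n := zero_lt_one.trans_le (one_le_T n)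
  have hN0 : (0 : ℝ) < D.N n := zero_lt_one.trans_le (one_le_N n)
  have e : -a * (1 - 2 / (M : ℝ)) + 1 = -κ + 1 := by rw [hκ]; ring
  rw [polyRate, add_div, e]
  congr 1
  rw [← Real.rpow_mul hT0.le, targetRate]
  field_simp

theorem tendsto_rpow_div_T {ρ : ℝ} (hT : Tendsto (fun n => (D.T n : ℝ)) atTop atTop)
    (hρ : ρ < 1) : Tendsto (fun n => (D.T n : ℝ) ^ ρ / (D.T n : ℝ)) atTop (𝓝 0) := by
  refine ((tendsto_rpow_neg_atTop (y := 1 - ρ) (by linarith)).comp hT).congr fun n => ?_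
  have hT0 : (0 : ℝ) < D.T n := zero_lt_one.trans_le (one_le_T n)
  simp only [Function.comp]
  rw [neg_sub, Real.rpow_sub_one hT0.ne']

variable [IsProbabilityMeasure P]

theorem tailBound_of_polyMixing (hM : 16 ≤ M) (hB : D.BasicAssumptions P M)
    (hReg : D.RegressorConvergence P) (hPred : D.BoundedPredictors)
    (hT : Tendsto (fun n => (D.T n : ℝ)) atTop atTop) {a : ℝ} (ha : 8 ≤ a)
    (hκ : 2 ≤ a * (1 - 2 / (M : ℝ))) (hmix : D.PolyMixing P a) {b : ℕ → ℝ} (hb : ∀ n, 1 ≤ b n)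
    (hbT : Tendsto (fun n => b n / (D.T n : ℝ)) atTop (𝓝 0)) :
    TailBound P (fun n ω => |D.E1Hat n (b n) ω - D.E1 n ω|) (D.polyRate M a b) := by
  obtain ⟨k, hk, hacov⟩ := hmix.abs_acov_le hB (by omega) (by linarith)
  obtain ⟨C, hC⟩ := hmix.alphaMixing_mul_le ha
  refine (tailBound hB hM hReg hPred hC hT (Eventually.of_forall hb) hbT
    (τ := fun n => k * (2 * b n ^ (-a * (1 - 2 / (M : ℝ)) + 1)))
    (Eventually.of_forall fun n i => ?_)).mono (C := 1 + 2 * k) (by positivity)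
    (Eventually.of_forall fun n => ?_)
  · have hb0 : 0 < b n := zero_lt_one.trans_le (hb n)
    have hsum := sum_Ico_rpow_le hκ hb0 (D.T n)
    rw [← neg_mul] at hsum
    refine le_trans ?_ (mul_le_mul_of_nonneg_left hsum hk)
    rw [Finset.mul_sum]
    refine Finset.sum_le_sum fun h hh => ?_
    have hh' := Finset.mem_Ico.1 hh
    exact hacov n i h ((Nat.one_le_ceil_iff.2 hb0).trans hh'.1) hh'.2
  · have hb0 : 0 < b n := zero_lt_one.trans_le (hb n)
    have hT0 : (0 : ℝ) < D.T n := zero_lt_one.trans_le (one_le_T n)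
    have h1 : 0 < D.rate b n := rate_pos hb0
    have h2 : 0 ≤ b n ^ (-a * (1 - 2 / (M : ℝ)) + 1) / (D.T n : ℝ) := by positivity
    have e : k * (2 * b n ^ (-a * (1 - 2 / (M : ℝ)) + 1)) / (D.T n : ℝ)
        = 2 * k * (b n ^ (-a * (1 - 2 / (M : ℝ)) + 1) / (D.T n : ℝ)) := by ring
    rw [e, polyRate]
    nlinarith [mul_nonneg hk h1.le]

/-- A bandwidth of larger order than `log T` makes the geometric tail `O(1/T)`. Its contribution
`O(1/T²)` is absorbed by `b / T²`. -/
theorem tailBound_of_expMixing (hM : 16 ≤ M) (hB : D.BasicAssumptions P M)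
    (hReg : D.RegressorConvergence P) (hPred : D.BoundedPredictors)
    (hT : Tendsto (fun n => (D.T n : ℝ)) atTop atTop) (hmix : D.ExpMixing P) {b : ℕ → ℝ}
    (hb : ∀ n, 0 < b n) (hlog : Tendsto (fun n => Real.log (D.T n : ℝ) / b n) atTop (𝓝 0))
    (hbT : Tendsto (fun n => b n / (D.T n : ℝ)) atTop (𝓝 0)) :
    TailBound P (fun n ω => |D.E1Hat n (b n) ω - D.E1 n ω|) (D.rate b) := by
  obtain ⟨k, q, r₀, hk, hq0, hq1, hacov⟩ := hmix.abs_acov_le hB (by omega)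
  obtain ⟨C, hC⟩ := hmix.alphaMixing_mul_le
  -- Eventually `b ≥ log T`, and `T → ∞`.
  have hbtop : Tendsto b atTop atTop := by
    refine tendsto_atTop_mono' _ ?_ (Real.tendsto_log_atTop.comp hT)
    filter_upwards [hlog.eventually (gt_mem_nhds one_pos)] with n hn
    rw [div_lt_one (hb n)] at hn
    exact hn.le
  have hq : 0 < -Real.log q := neg_pos.2 (Real.log_neg hq0 hq1)
  have hk' : 0 ≤ k / (1 - q) := div_nonneg hk (by linarith)
  refine (tailBound hB hM hReg hPred hC hT (hbtop.eventually_ge_atTop 1) hbT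
    (τ := fun n => k / (1 - q) * (1 / (D.T n : ℝ))) ?_).mono (C := 1 + k / (1 - q))
    (by positivity) ?_
  · filter_upwards [hlog.eventually (gt_mem_nhds hq), hbtop.eventually_ge_atTop (r₀ : ℝ)]
      with n hn hrn i
    have hT0 : (0 : ℝ) < D.T n := zero_lt_one.trans_le (one_le_T n)
    have hbm : b n ≤ ⌈b n⌉₊ := Nat.le_ceil _
    have hrm : r₀ ≤ ⌈b n⌉₊ := by exact_mod_cast hrn.trans hbm
    have hqm : q ^ ⌈b n⌉₊ ≤ 1 / (D.T n : ℝ) := by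
      rw [div_lt_iff₀ (hb n)] at hn
      rw [← Real.rpow_natCast]
      calc q ^ (⌈b n⌉₊ : ℝ) ≤ q ^ b n := Real.rpow_le_rpow_of_exponent_ge hq0 hq1.le hbm
        _ = Real.exp (Real.log q * b n) := Real.rpow_def_of_pos hq0 _
        _ ≤ Real.exp (-Real.log (D.T n)) := Real.exp_le_exp.2 (by linarith)
        _ = 1 / (D.T n : ℝ) := by rw [Real.exp_neg, Real.exp_log hT0, one_div]
    calc ∑ h ∈ Finset.Ico ⌈b n⌉₊ (D.T n), |D.acov n i h|
        ≤ ∑ h ∈ Finset.Ico ⌈b n⌉₊ (D.T n), k * q ^ h := Finset.sum_le_sum fun h hh => by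
          have hh' := Finset.mem_Ico.1 hh
          exact hacov n i h (hrm.trans hh'.1) hh'.2
      _ = k * ∑ h ∈ Finset.Ico ⌈b n⌉₊ (D.T n), q ^ h := by rw [Finset.mul_sum]
      _ ≤ k * (q ^ ⌈b n⌉₊ / (1 - q)) := by
          gcongr
          exact geom_sum_Ico_le_of_lt_one hq0.le hq1
      _ = k / (1 - q) * q ^ ⌈b n⌉₊ := by ring
      _ ≤ _ := by gcongr
  · filter_upwards [hbtop.eventually_ge_atTop 1] with n hbn
    have hN0 : (0 : ℝ) < D.N n := zero_lt_one.trans_le (one_le_N n)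
    have hT0 : (0 : ℝ) < D.T n := zero_lt_one.trans_le (one_le_T n)
    have hb0 := hb n
    have h1 : 1 / (D.T n : ℝ) ^ 2 ≤ D.rate b n := by
      unfold rate
      have h2 : 1 / (D.T n : ℝ) ^ 2 ≤ b n / (D.T n : ℝ) ^ 2 := by gcongr
      have h3 : 0 ≤ b n ^ (7 / 4 : ℝ) / (√(D.N n : ℝ) * (D.T n : ℝ) ^ (3 / 2 : ℝ)) := by
        positivity
      linarith
    have e : k / (1 - q) * (1 / (D.T n : ℝ)) / (D.T n : ℝ)
        = k / (1 - q) * (1 / (D.T n : ℝ) ^ 2) := by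
      rw [sq, ← div_div]; ring
    rw [e, add_mul, one_mul]
    gcongr

end PanelArray

/-! ### Both mixing regimes assembled. -/

theorem lemma4 {Ω : Type*} [MeasurableSpace Ω] (P : Measure Ω) [IsProbabilityMeasure P] {K : ℕ}
    (D : PanelArray Ω K) (M : ℕ) (hM : 16 ≤ M)
    (hBasic : D.BasicAssumptions P M) (hReg : D.RegressorConvergence P)
    (hPred : D.BoundedPredictors) (hHet : D.ModerateHeterogeneity)
    (η : ℝ) (hη : 0 < η)
    (hNT : Tendsto (fun n => (D.N n : ℝ) / (D.T n : ℝ) ^ η) atTop (𝓝 0)) :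
    -- exponential mixing
    (D.BoundedSlopes → D.ExpMixing P → η < 2 →
      (∀ b : ℕ → ℝ, (∀ n, 0 < b n) →
        Tendsto (fun n => Real.log (D.T n : ℝ) / b n) atTop (𝓝 0) →
        Tendsto (fun n => b n / (D.T n : ℝ)) atTop (𝓝 0) →
        IsCondBigOP P D.allX (fun n ω => |D.E1Hat n (b n) ω - D.E1 n ω|) (D.rate b)) ∧
      (∀ ρ : ℝ, 0 < ρ → ρ < min (1 - η / 2) (2 / 7) →
        Tendsto (fun n => D.rate (fun m => (D.T m : ℝ) ^ ρ) n / D.targetRate n) atTop (𝓝 0) ∧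
        IsCondLittleOP P D.allX
          (fun n ω => |D.E1Hat n ((D.T n : ℝ) ^ ρ) ω - D.E1 n ω|) D.targetRate)) ∧
    -- polynomial mixing
    (∀ a : ℝ, 24 * ((M : ℝ) + 2) / ((M : ℝ) - 3) < a → D.PolyMixing P a →
      η ≤ 2 - 2 * (M : ℝ) / (a * ((M : ℝ) - 2) + (M : ℝ)) →
      (∀ b : ℕ → ℝ, (∀ n, 1 ≤ b n) →
        Tendsto (fun n => b n / (D.T n : ℝ)) atTop (𝓝 0) →
        IsCondBigOP P D.allX (fun n ω => |D.E1Hat n (b n) ω - D.E1 n ω|) (D.polyRate M a b)) ∧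
      (∀ ρ : ℝ, η / (a * (1 - 2 / (M : ℝ)) + 1) < ρ → ρ < min (1 - η / 2) (2 / 7) →
        Tendsto (fun n => D.polyRate M a (fun m => (D.T m : ℝ) ^ ρ) n / D.targetRate n)
          atTop (𝓝 0) ∧
        IsCondLittleOP P D.allX
          (fun n ω => |D.E1Hat n ((D.T n : ℝ) ^ ρ) ω - D.E1 n ω|) D.targetRate)) := by
  have hT := PanelArray.tendsto_T_atTop hη hNT
  have hX : ∀ n, Measurable (D.allX n) := PanelArray.measurable_allX
  have hT1 : ∀ n, (1 : ℝ) ≤ D.T n := PanelArray.one_le_T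
  have hT0 : ∀ n, (0 : ℝ) < D.T n := fun n => zero_lt_one.trans_le (hT1 n)
  refine ⟨fun _ hmix _ => ⟨fun b hb hlog hbT => ?_, fun ρ hρ0 hρ => ?_⟩,
    fun a ha hmix _ => ?_⟩
  · exact (PanelArray.tailBound_of_expMixing hM hBasic hReg hPred hT hmix hb hlog hbT).isCondBigOP
      (Eventually.of_forall fun n => PanelArray.rate_pos (hb n)) hX
  · have hrate := PanelArray.tendsto_rate_div_targetRate hη hNT hρ
    have hρ2 := hρ.trans_le (min_le_right _ _)
    refine ⟨hrate, (PanelArray.tailBound_of_expMixing hM hBasic hReg hPred hT hmix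
      (b := fun n => (D.T n : ℝ) ^ ρ) (fun n => Real.rpow_pos_of_pos (hT0 n) ρ) ?_
      (PanelArray.tendsto_rpow_div_T hT (by linarith))).isCondLittleOP
      PanelArray.targetRate_pos hrate hX⟩
    exact (isLittleO_log_rpow_atTop hρ0).tendsto_div_nhds_zero.comp hT
  · have hM' : (16 : ℝ) ≤ M := by exact_mod_cast hM
    -- Since `M + 2 ≥ M - 3`, the hypothesis on `a` gives `a > 24`. With `2 / M ≤ 1/8` this supplies
    -- both `a ≥ 8` and `κ ≥ 3`.
    have ha24 : 24 < a := by
      refine lt_of_le_of_lt ?_ ha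
      rw [le_div_iff₀ (by linarith)]
      linarith
    have hM2 : 2 / (M : ℝ) ≤ 1 / 8 := by
      rw [div_le_iff₀ (by linarith)]; linarith
    have hκ : 3 ≤ a * (1 - 2 / (M : ℝ)) := by nlinarith
    have hbound := fun (b : ℕ → ℝ) (hb : ∀ n, 1 ≤ b n) hbT =>
      PanelArray.tailBound_of_polyMixing hM hBasic hReg hPred hT (by linarith) (by linarith)
        hmix hb hbT
    refine ⟨fun b hb hbT => (hbound b hb hbT).isCondBigOP (Eventually.of_forall fun n => ?_) hX,
      fun ρ hρ' hρ => ?_⟩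
    · have hb0 : 0 < b n := zero_lt_one.trans_le (hb n)
      have h1 : 0 < D.rate b n := PanelArray.rate_pos hb0
      have h2 := hT0 n
      unfold PanelArray.polyRate
      positivity
    · have hrate := PanelArray.tendsto_polyRate_div_targetRate hη hNT hρ hκ hρ'
      have hρ2 := hρ.trans_le (min_le_right _ _)
      have hρ0 : 0 ≤ ρ := (div_nonneg hη.le (by linarith)).trans hρ'.le
      exact ⟨hrate, (hbound (fun n => (D.T n : ℝ) ^ ρ) (fun n => Real.one_le_rpow (hT1 n) hρ0)
        (PanelArray.tendsto_rpow_div_T hT (by linarith))).isCondLittleOP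
        PanelArray.targetRate_pos hrate hX⟩
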